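/- Let $(A,\mathfrak m)$ be a one-dimensional (Noetherian) Cohen-Macaulay local ring with infinite residue field $K=A/\mathfrak m$, embedding dimension $b=\lambda(\mathfrak m/\mathfrak m^2)$ and multiplicity $e$, that is, $\sum_{i=0}^n\lambda(\mathfrak m^i/\mathfrak m^{i+1})=e(n+1)-\rho$ for some integer $\rho$ and all large $n$ ($\lambda$ denotes length). Let $xA$ be a minimal reduction of $\mathfrak m$ and let $r$ be the least integer with $\mathfrak m^{r+1}=x\mathfrak m^r$. Let $G(\mathfrak m)=\bigoplus_{n\ge0}\mathfrak m^n/\mathfrak m^{n+1}$ be the tangent cone, let $F(x)=\bigoplus_{n\ge 0}x^nA/x^n\mathfrak m\hookrightarrow G(\mathfrak m)$, let $x^*$ be the class of $x$ in degree $1$, and regard $G(\mathfrak m)$ as a graded $K[X]$-module with $X$ acting as $x^*$. Let $A'$ be the first neighborhood ring of $A$: the set of all $b/a$ in the total ring of fractions of $A$ with $b\in\mathfrak m^s$ and $a\in\mathfrak m^s$ superficial of degree $s$ (that is, $\mathfrak m^{n+s}=a\mathfrak m^n$ for all large $n$). Consider the following invariants. - The invariants $\alpha_i$ ($0\le i\le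 r$) and $\alpha_{i,j}$ of the tangent cone, given by a decomposition $$G(\mathfrak m)\cong\bigoplus_{i=0}^{r}F(x)(-i)^{\alpha_i}\oplus\bigoplus_{i=1}^{r-1}\bigoplus_{j=1}^{r-i}\Bigl(\frac{F(x)}{(x^*)^jF(x)}(-i)\Bigr)^{\alpha_{i,j}}$$ of graded $F(x)$-modules (with $\alpha_i=0$ for $i>r$). - The micro-invariants $\beta_i=\lambda\bigl(\frac{A+\mathfrak m^{i-1}A'}{A+\mathfrak m^iA'}\bigr)-\lambda\bigl(\frac{A+\mathfrak m^{i}A'}{A+\mathfrak m^{i+1}A'}\bigr)$, $i\ge1$. - The Apery invariants $\gamma_i=\lambda\bigl(\frac{\mathfrak m^i+xA}{\mathfrak m^{i+1}+xA}\bigr)$. If $b=2$, then: 1. a decomposition as above exists and, for any such decomposition, $\alpha_i=\beta_i=\gamma_i=1$ for $1\le i\le e-1$; 2. $G(\mathfrak m)\cong\bigoplus_{i=0}^{e-1}K[X](-i)$ as graded $K[X]$-modules; 3. the Hilbert series of the associated graded ring of $\mathfrak m/xA\subset A/xA$ is $H_{G(\mathfrak m/xA)}(z)=1+z+\cdots+z^{e-1}$;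 4. if $A$ is equicharacteristic and complete, then $A$ has a coefficient field and, for every coefficient field $K\subset A$, $A'/A\cong\bigoplus_{i=1}^{e-1}K[[X]]/X^iK[[X]]$ as $K[[X]]$-modules, where $K[[X]]$ acts through the homomorphism $K[[X]]\to A$ that is the inclusion on $K$ and sends $X$ to $x$. If $A$ has minimal multiplicity, that is, $b=e$, then: 1. a decomposition as above exists and, for any such decomposition, $\alpha_1=\beta_1=\gamma_1=e-1$; 2. $G(\mathfrak m)\cong K[X]\oplus K[X](-1)^{e-1}$ as graded $K[X]$-modules; 3. $H_{G(\mathfrak m/xA)}(z)=1+(e-1)z$; 4. if $A$ is equicharacteristic and complete, then $A$ has a coefficient field and, for every coefficient field $K\subset A$, $A'/A\cong\bigl(K[[X]]/XK[[X]]\bigr)^{e-1}$ as $K[[X]]$-modules, with $K[[X]]$ acting as above. -/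

import Mathlib

open IsLocalRing Polynomial PowerSeries DirectSum

universe u

noncomputable section

namespace TangentCone

/-! ### Lengths, Hilbert functions, multiplicity -/

/-- The length `λ(N / N')` of the subquotient `N / (N ∩ N')` (used for `N' ≤ N`), as a natural
number. -/
def lengthQuot {R M : Type*} [CommRing R] [AddCommGroup M] [Module R M]
    (N N' : Submodule R M) : ℕ :=
  (Module.length R (↥N ⧸ N'.submoduleOf N)).toNat

/-- The Hilbert function `n ↦ λ(Iⁿ / Iⁿ⁺¹)` of an ideal. -/
def hilbertFunction {R : Type*} [CommRing R] (I : Ideal R) (n : ℕ) : ℕ :=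
  lengthQuot (I ^ n) (I ^ (n + 1))

/-- The Hilbert series `∑ λ(Iⁿ / Iⁿ⁺¹) zⁿ` of the associated graded ring of an ideal. -/
def hilbertSeries {R : Type*} [CommRing R] (I : Ideal R) : ℤ⟦X⟧ :=
  PowerSeries.mk fun n => (hilbertFunction I n : ℤ)

/-- The Hilbert-Samuel function `H¹(n) = ∑_{i = 0}^{n} λ(𝔪ⁱ / 𝔪ⁱ⁺¹)` of a local ring. -/
def hilbertSamuel (A : Type*) [CommRing A] [IsLocalRing A] (n : ℕ) : ℕ :=
  ∑ i ∈ Finset.range (n + 1), hilbertFunction (maximalIdeal A) i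

/-- `e` is the multiplicity of the one-dimensional local ring `A`:
`H¹(n) = e (n + 1) - ρ` for some integer `ρ` and all large `n`. -/
def IsMultiplicity (A : Type*) [CommRing A] [IsLocalRing A] (e : ℕ) : Prop :=
  ∃ ρ : ℤ, ∀ᶠ n : ℕ in Filter.atTop, (hilbertSamuel A n : ℤ) = e * (n + 1) - ρ

/-- At most one natural number satisfies the definition of the multiplicity. -/
theorem IsMultiplicity.unique {A : Type*} [CommRing A] [IsLocalRing A] {e e' : ℕ}
    (h : IsMultiplicity A e) (h' : IsMultiplicity A e') : e = e' := by
  obtain ⟨ρ, h⟩ := h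
  obtain ⟨ρ', h'⟩ := h'
  obtain ⟨N, hN⟩ := Filter.eventually_atTop.1 (h.and h')
  obtain ⟨h1, h2⟩ := hN N le_rfl
  obtain ⟨h3, h4⟩ := hN (N + 1) (Nat.le_succ N)
  push_cast at h3 h4
  have : (e : ℤ) = e' := by linarith
  exact_mod_cast this

open Classical in
/-- The multiplicity of a one-dimensional local ring. -/
def multiplicity (A : Type*) [CommRing A] [IsLocalRing A] : ℕ :=
  if h : ∃ e, IsMultiplicity A e then h.choose else 0

/-- The multiplicity is computed by its defining property. -/
theorem IsMultiplicity.multiplicity_eq {A : Type*} [CommRing A] [IsLocalRing A] {e : ℕ}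
    (h : IsMultiplicity A e) : multiplicity A = e := by
  have h' : ∃ e, IsMultiplicity A e := ⟨e, h⟩
  unfold multiplicity
  rw [dif_pos h']
  exact h'.choose_spec.unique h

/-- The embedding dimension `b = λ(𝔪 / 𝔪²)`. -/
def embDim (A : Type*) [CommRing A] [IsLocalRing A] : ℕ :=
  lengthQuot (maximalIdeal A) (maximalIdeal A ^ 2)

/-- A Noetherian local ring is Cohen-Macaulay if it has a regular sequence in the maximal ideal
whose length is the Krull dimension. -/
def IsCohenMacaulayLocal (A : Type*) [CommRing A] [IsLocalRing A] : Prop :=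
  ∃ rs : List A, (∀ a ∈ rs, a ∈ maximalIdeal A) ∧ RingTheory.Sequence.IsRegular A rs ∧
    ((rs.length : ℕ∞) : WithBot ℕ∞) = ringKrullDim A

/-! ### Reductions -/

/-- `J` is a reduction of `I`. -/
def IsReduction {A : Type*} [CommRing A] (J I : Ideal A) : Prop :=
  J ≤ I ∧ ∃ n : ℕ, I ^ (n + 1) = J * I ^ n

/-- `J` is a minimal reduction of `I`. -/
def IsMinimalReduction {A : Type*} [CommRing A] (J I : Ideal A) : Prop :=
  Minimal (fun J' => IsReduction J' I) J

/-- The reduction number of `𝔪` with respect to `xA`: the least `r` with `𝔪ʳ⁺¹ = x 𝔪ʳ`. -/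
def reductionNumber {A : Type*} [CommRing A] [IsLocalRing A] (x : A) : ℕ :=
  sInf {r | maximalIdeal A ^ (r + 1) = Ideal.span {x} * maximalIdeal A ^ r}

/-! ### The graded rings `F(I) = ⨁ Iⁿ / 𝔪 Iⁿ`

For `I = 𝔪` this is the tangent cone `G(𝔪) = ⨁ 𝔪ⁿ / 𝔪ⁿ⁺¹`; for `I = xA` it is
`F(x) = ⨁ xⁿA / xⁿ𝔪`. -/

section FiberCone

variable {A : Type u} [CommRing A] [IsLocalRing A]

/-- The component `Iⁿ / 𝔪 Iⁿ`. -/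
def FiberPiece (I : Ideal A) (n : ℕ) : Type u :=
  ↥(I ^ n) ⧸ (maximalIdeal A * I ^ n).submoduleOf (I ^ n)

instance (I : Ideal A) (n : ℕ) : AddCommGroup (FiberPiece I n) :=
  inferInstanceAs (AddCommGroup (↥(I ^ n) ⧸ (maximalIdeal A * I ^ n).submoduleOf (I ^ n)))

instance (I : Ideal A) (n : ℕ) : Module A (FiberPiece I n) :=
  inferInstanceAs (Module A (↥(I ^ n) ⧸ (maximalIdeal A * I ^ n).submoduleOf (I ^ n)))

/-- The class in `Iⁿ / 𝔪 Iⁿ` of an element of `Iⁿ`. -/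
def FiberPiece.mk (I : Ideal A) (n : ℕ) : ↥(I ^ n) →ₗ[A] FiberPiece I n :=
  Submodule.mkQ _

theorem FiberPiece.mk_surjective (I : Ideal A) (n : ℕ) :
    Function.Surjective (FiberPiece.mk I n) :=
  Submodule.mkQ_surjective _

theorem FiberPiece.mk_eq_mk (I : Ideal A) (n : ℕ) (a b : ↥(I ^ n)) :
    FiberPiece.mk I n a = FiberPiece.mk I n b ↔ (a : A) - b ∈ maximalIdeal A * I ^ n :=
  Submodule.Quotient.eq _

/-- The product `Iⁱ × Iʲ → Iⁱ⁺ʲ`. -/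
def powMul (I : Ideal A) {i j : ℕ} (a : ↥(I ^ i)) (b : ↥(I ^ j)) : ↥(I ^ (i + j)) :=
  ⟨(a : A) * b, by rw [pow_add]; exact Ideal.mul_mem_mul a.2 b.2⟩

/-- The product `Iⁱ / 𝔪 Iⁱ × Iʲ / 𝔪 Iʲ → Iⁱ⁺ʲ / 𝔪 Iⁱ⁺ʲ` induced by the product of `A`. -/
def FiberPiece.mul (I : Ideal A) {i j : ℕ} (a : FiberPiece I i) (b : FiberPiece I j) :
    FiberPiece I (i + j) :=
  Quotient.liftOn₂ a b (fun a b => FiberPiece.mk I (i + j) (powMul I a b)) (by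
    intro a b a' b' ha hb
    have ha' := (FiberPiece.mk_eq_mk I i a a').1 (Quotient.sound ha)
    have hb' := (FiberPiece.mk_eq_mk I j b b').1 (Quotient.sound hb)
    rw [FiberPiece.mk_eq_mk]
    have e : ((powMul I a b : ↥(I ^ (i + j))) : A) - powMul I a' b'
        = ((a : A) - a') * b + a' * ((b : A) - b') := by
      simp only [powMul]; ring
    rw [e]
    refine Ideal.add_mem _ ?_ ?_
    · rw [pow_add, ← mul_assoc]
      exact Ideal.mul_mem_mul ha' b.2
    · rw [pow_add, mul_left_comm]
      exact Ideal.mul_mem_mul a'.2 hb')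

/-- The element `a ∈ I⁰ = A`. -/
def powZero (I : Ideal A) (a : A) : ↥(I ^ 0) := ⟨a, by simp⟩

theorem FiberPiece.sigma_ext (I : Ideal A) {i j : ℕ} (h : i = j) (a : ↥(I ^ i)) (b : ↥(I ^ j))
    (hab : (a : A) = b) :
    (GradedMonoid.mk i (FiberPiece.mk I i a) : GradedMonoid (FiberPiece I))
      = GradedMonoid.mk j (FiberPiece.mk I j b) := by
  subst h
  obtain rfl : a = b := Subtype.ext hab
  rfl

instance (I : Ideal A) : GradedMonoid.GOne (FiberPiece I) where
  one := FiberPiece.mk I 0 (powZero I 1)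

instance (I : Ideal A) : GradedMonoid.GMul (FiberPiece I) where
  mul := FiberPiece.mul I

theorem FiberPiece.mk_mul_mk (I : Ideal A) {i j : ℕ} (a : ↥(I ^ i)) (b : ↥(I ^ j)) :
    GradedMonoid.GMul.mul (FiberPiece.mk I i a) (FiberPiece.mk I j b)
      = FiberPiece.mk I (i + j) (powMul I a b) :=
  rfl

instance (I : Ideal A) : DirectSum.GCommRing (FiberPiece I) where
  mul_zero {i j} a := by
    obtain ⟨a, rfl⟩ := FiberPiece.mk_surjective I i a
    rw [← map_zero (FiberPiece.mk I j), FiberPiece.mk_mul_mk, ← map_zero (FiberPiece.mk I (i + j))]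
    exact congrArg _ (Subtype.ext (mul_zero _))
  zero_mul {i j} b := by
    obtain ⟨b, rfl⟩ := FiberPiece.mk_surjective I j b
    rw [← map_zero (FiberPiece.mk I i), FiberPiece.mk_mul_mk, ← map_zero (FiberPiece.mk I (i + j))]
    exact congrArg _ (Subtype.ext (zero_mul _))
  mul_add {i j} a b c := by
    obtain ⟨a, rfl⟩ := FiberPiece.mk_surjective I i a
    obtain ⟨b, rfl⟩ := FiberPiece.mk_surjective I j b
    obtain ⟨c, rfl⟩ := FiberPiece.mk_surjective I j c
    rw [← map_add, FiberPiece.mk_mul_mk, FiberPiece.mk_mul_mk, FiberPiece.mk_mul_mk, ← map_add]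
    exact congrArg _ (Subtype.ext (mul_add _ _ _))
  add_mul {i j} a b c := by
    obtain ⟨a, rfl⟩ := FiberPiece.mk_surjective I i a
    obtain ⟨b, rfl⟩ := FiberPiece.mk_surjective I i b
    obtain ⟨c, rfl⟩ := FiberPiece.mk_surjective I j c
    rw [← map_add, FiberPiece.mk_mul_mk, FiberPiece.mk_mul_mk, FiberPiece.mk_mul_mk, ← map_add]
    exact congrArg _ (Subtype.ext (add_mul _ _ _))
  one_mul := by
    rintro ⟨i, a⟩
    obtain ⟨a, rfl⟩ := FiberPiece.mk_surjective I i a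
    exact FiberPiece.sigma_ext I (zero_add i) (powMul I (powZero I 1) a) a (one_mul _)
  mul_one := by
    rintro ⟨i, a⟩
    obtain ⟨a, rfl⟩ := FiberPiece.mk_surjective I i a
    exact FiberPiece.sigma_ext I (add_zero i) (powMul I a (powZero I 1)) a (mul_one _)
  mul_assoc := by
    rintro ⟨i, a⟩ ⟨j, b⟩ ⟨k, c⟩
    obtain ⟨a, rfl⟩ := FiberPiece.mk_surjective I i a
    obtain ⟨b, rfl⟩ := FiberPiece.mk_surjective I j b
    obtain ⟨c, rfl⟩ := FiberPiece.mk_surjective I k c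
    exact FiberPiece.sigma_ext I (add_assoc i j k) (powMul I (powMul I a b) c)
      (powMul I a (powMul I b c)) (mul_assoc _ _ _)
  mul_comm := by
    rintro ⟨i, a⟩ ⟨j, b⟩
    obtain ⟨a, rfl⟩ := FiberPiece.mk_surjective I i a
    obtain ⟨b, rfl⟩ := FiberPiece.mk_surjective I j b
    exact FiberPiece.sigma_ext I (add_comm i j) (powMul I a b) (powMul I b a) (mul_comm _ _)
  natCast n := FiberPiece.mk I 0 (powZero I n)
  natCast_zero := by
    rw [← map_zero (FiberPiece.mk I 0)]
    exact congrArg _ (Subtype.ext Nat.cast_zero)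
  natCast_succ n := by
    refine Eq.trans ?_ (map_add (FiberPiece.mk I 0) (powZero I n) (powZero I 1))
    exact congrArg _ (Subtype.ext (Nat.cast_succ n))
  intCast n := FiberPiece.mk I 0 (powZero I n)
  intCast_ofNat n := congrArg (FiberPiece.mk I 0) (Subtype.ext (Int.cast_natCast n))
  intCast_negSucc_ofNat n := by
    refine Eq.trans ?_ (map_neg (FiberPiece.mk I 0) (powZero I _))
    exact congrArg _ (Subtype.ext (Int.cast_negSucc n))

/-- The graded ring `F(I) = ⨁ Iⁿ / 𝔪 Iⁿ`. -/
abbrev FiberCone (I : Ideal A) : Type u := ⨁ n, FiberPiece I n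

/-- The homogeneous elements of degree `n` of `F(I)`. -/
def FiberCone.piece (I : Ideal A) (n : ℕ) : AddSubgroup (FiberCone I) :=
  (DirectSum.of (FiberPiece I) n).range

/-- The class in degree `1` of an element of `I`. -/
def FiberCone.ofDegreeOne (I : Ideal A) (a : A) (ha : a ∈ I) : FiberCone I :=
  DirectSum.of (FiberPiece I) 1 (FiberPiece.mk I 1 ⟨a, by rwa [pow_one]⟩)

/-- The map `Iⁿ / 𝔪 Iⁿ → Jⁿ / 𝔪 Jⁿ` induced by an inclusion `I ≤ J`. -/
def FiberPiece.map {I J : Ideal A} (h : I ≤ J) (n : ℕ) : FiberPiece I n →ₗ[A] FiberPiece J n :=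
  Submodule.mapQ _ _ (Submodule.inclusion (Ideal.pow_right_mono h n))
    (fun _ ha => Ideal.mul_mono_right (Ideal.pow_right_mono h n) ha)

/-- The graded ring homomorphism `F(I) → F(J)` induced by an inclusion `I ≤ J`. -/
def FiberCone.map {I J : Ideal A} (h : I ≤ J) : FiberCone I →+* FiberCone J :=
  DirectSum.toSemiring
    (fun n => (DirectSum.of (FiberPiece J) n).comp (FiberPiece.map h n).toAddMonoidHom)
    rfl
    (by
      intro i j a b
      obtain ⟨a, rfl⟩ := FiberPiece.mk_surjective I i a
      obtain ⟨b, rfl⟩ := FiberPiece.mk_surjective I j b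
      exact (DirectSum.of_mul_of (A := FiberPiece J) (FiberPiece.map h i (FiberPiece.mk I i a))
        (FiberPiece.map h j (FiberPiece.mk I j b))).symm)

/-- The structure map `A → F(I)`, with values in degree `0`. -/
def FiberCone.ofRing (I : Ideal A) : A →+* FiberCone I where
  toFun a := DirectSum.of (FiberPiece I) 0 (FiberPiece.mk I 0 (powZero I a))
  map_one' := rfl
  map_zero' := by
    rw [show powZero I 0 = 0 from rfl, map_zero, map_zero]
  map_mul' a b := by
    rw [DirectSum.of_mul_of]
    rfl
  map_add' a b := by
    rw [← map_add, ← map_add]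
    rfl

/-- The structure map `K = A / 𝔪 → F(I)` of `F(I)` as an algebra over the residue field. -/
def FiberCone.ofResidueField (I : Ideal A) : ResidueField A →+* FiberCone I :=
  Ideal.Quotient.lift (maximalIdeal A) (FiberCone.ofRing I) (by
    intro a ha
    change DirectSum.of (FiberPiece I) 0 (FiberPiece.mk I 0 (powZero I a)) = 0
    rw [show FiberPiece.mk I 0 (powZero I a) = 0 from ?_, map_zero]
    rw [← map_zero (FiberPiece.mk I 0), FiberPiece.mk_eq_mk]
    simpa [powZero] using ha)

/-! ### Graded modules and the decomposition of the tangent cone -/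

/-- The homogeneous elements of degree `n` of the shifted graded module `M(-d)`, that is
`M_{n - d}`. -/
def shiftPiece {M : Type*} [AddCommGroup M] (ℳ : ℕ → AddSubgroup M) (d n : ℕ) : AddSubgroup M :=
  if d ≤ n then ℳ (n - d) else ⊥

/-- The homogeneous elements of degree `n` of the finite direct sum `⨁ᵢ Mᵢ(-dᵢ)`. -/
def sumPiece {ι : Type*} {M : ι → Type*} [∀ i, AddCommGroup (M i)]
    (ℳ : ∀ i, ℕ → AddSubgroup (M i)) (d : ι → ℕ) (n : ℕ) : AddSubgroup (∀ i, M i) :=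
  AddSubgroup.pi Set.univ fun i => shiftPiece (ℳ i) (d i) n

/-- The pairs `(i, j)` with `1 ≤ i ≤ r - 1` and `1 ≤ j ≤ r - i`. -/
abbrev TorsionIndex (r : ℕ) : Type := {p : ℕ × ℕ // 1 ≤ p.1 ∧ p.1 < r ∧ 1 ≤ p.2 ∧ p.1 + p.2 ≤ r}

/-- `α` and `τ` are the invariants `αᵢ` and `α_{i,j}` of the tangent cone with respect to `x`:
`G(𝔪) ≅ ⨁_{0 ≤ i ≤ r} F(x)(-i)^{αᵢ} ⊕
  ⨁_{1 ≤ i ≤ r - 1} ⨁_{1 ≤ j ≤ r - i} (F(x) / (x*)ʲ F(x))(-i)^{α_{i,j}}`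
as graded `F(x)`-modules, where `r` is the reduction number; and, by convention, `αᵢ = 0` for
`i > r`. -/
def IsTangentConeInvariants (x : A) (hx : x ∈ maximalIdeal A) (α : ℕ → ℕ) (τ : ℕ → ℕ → ℕ) :
    Prop :=
  let r := reductionNumber x
  let F := FiberCone (Ideal.span {x})
  let xs : F := FiberCone.ofDegreeOne (Ideal.span {x}) x (Ideal.mem_span_singleton_self x)
  let incl : F →+* FiberCone (maximalIdeal A) :=
    FiberCone.map ((Ideal.span_singleton_le_iff_mem _).2 hx)
  let ι := Σ i : Fin (r + 1), Fin (α i)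
  let κ := Σ p : TorsionIndex r, Fin (τ p.1.1 p.1.2)
  (∀ i, r < i → α i = 0) ∧
  ∃ φ : FiberCone (maximalIdeal A) ≃+
      ((ι → F) × (∀ s : κ, F ⧸ Ideal.span {xs ^ s.1.1.2})),
    (∀ f g, φ (incl f * g) = f • φ g) ∧
    ∀ n g, g ∈ FiberCone.piece (maximalIdeal A) n ↔
      (φ g).1 ∈ sumPiece (fun _ : ι => FiberCone.piece (Ideal.span {x}))
        (fun s => (s.1 : ℕ)) n ∧
      (φ g).2 ∈ sumPiece
        (fun (s : κ) k => (FiberCone.piece (Ideal.span {x}) k).map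
          (Ideal.Quotient.mk (Ideal.span {xs ^ s.1.1.2})).toAddMonoidHom)
        (fun s => s.1.1.1) n

/-- The homogeneous polynomials `c Xⁿ` of degree `n`. -/
def polynomialPiece (K : Type*) [Field K] (n : ℕ) : AddSubgroup K[X] :=
  (Polynomial.monomial n : K →ₗ[K] K[X]).toAddMonoidHom.range

/-- The homomorphism `K[X] → G(𝔪)` of algebras over the residue field `K` that sends `X` to the
class `x*` of `x` in `𝔪 / 𝔪²`. -/
def polynomialToTangentCone (x : A) (hx : x ∈ maximalIdeal A) :
    (ResidueField A)[X] →+* FiberCone (maximalIdeal A) :=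
  Polynomial.eval₂RingHom (FiberCone.ofResidueField _) (FiberCone.ofDegreeOne _ x hx)

/-- `G(𝔪) ≅ ⨁ᵢ K[X](-dᵢ)` as graded `K[X]`-modules, with `X` acting on `G(𝔪)` as `x*`. -/
def TangentConeIsoFree (x : A) (hx : x ∈ maximalIdeal A) {ι : Type} [Fintype ι] (d : ι → ℕ) :
    Prop :=
  ∃ φ : FiberCone (maximalIdeal A) ≃+ (ι → (ResidueField A)[X]),
    (∀ p g, φ (polynomialToTangentCone x hx p * g) = p • φ g) ∧
    ∀ n g, g ∈ FiberCone.piece (maximalIdeal A) n ↔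
      φ g ∈ sumPiece (fun _ : ι => polynomialPiece (ResidueField A)) d n

end FiberCone

/-! ### The first neighborhood ring, micro-invariants and Apery invariants -/

section Neighborhood

variable (A : Type u) [CommRing A] [IsLocalRing A]

/-- `a` is superficial of degree `s`: `a ∈ 𝔪ˢ` and `𝔪ⁿ⁺ˢ = a 𝔪ⁿ` for all large `n`. -/
def IsSuperficial {A : Type u} [CommRing A] [IsLocalRing A] (s : ℕ) (a : A) : Prop :=
  a ∈ maximalIdeal A ^ s ∧
    ∀ᶠ n : ℕ in Filter.atTop, maximalIdeal A ^ (n + s) = Ideal.span {a} * maximalIdeal A ^ n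

variable {A} in
theorem IsSuperficial.mul {s t : ℕ} {a b : A} (ha : IsSuperficial s a) (hb : IsSuperficial t b) :
    IsSuperficial (s + t) (a * b) := by
  refine ⟨by rw [pow_add]; exact Ideal.mul_mem_mul ha.1 hb.1, ?_⟩
  have h := (Filter.tendsto_add_atTop_nat t).eventually ha.2
  filter_upwards [h, hb.2] with n h1 h2
  rw [← Ideal.span_singleton_mul_span_singleton, mul_assoc, ← h2, ← h1]
  congr 1
  omega

variable {A} in
theorem IsSuperficial.one : IsSuperficial 0 (1 : A) :=
  ⟨by simp, Filter.Eventually.of_forall fun n => by simp⟩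

/-- The first neighborhood ring `A'` of `A`: the elements `b / a` of the total ring of fractions
with `b ∈ 𝔪ˢ` and `a` a (regular) superficial element of degree `s`. -/
def firstNeighborhood : Subalgebra A (FractionRing A) where
  carrier := {y | ∃ (s : ℕ) (a : nonZeroDivisors A) (b : A), IsSuperficial s (a : A) ∧
    b ∈ maximalIdeal A ^ s ∧ y = IsLocalization.mk' (FractionRing A) b a}
  mul_mem' := by
    rintro _ _ ⟨s, a, b, ha, hb, rfl⟩ ⟨t, c, d, hc, hd, rfl⟩
    refine ⟨s + t, a * c, b * d, ha.mul hc, ?_, (IsLocalization.mk'_mul _ _ _ _ _).symm⟩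
    rw [pow_add]
    exact Ideal.mul_mem_mul hb hd
  add_mem' := by
    rintro _ _ ⟨s, a, b, ha, hb, rfl⟩ ⟨t, c, d, hc, hd, rfl⟩
    refine ⟨s + t, a * c, b * c + d * a, ha.mul hc, ?_, (IsLocalization.mk'_add _ _ _ _).symm⟩
    rw [pow_add]
    refine Ideal.add_mem _ (Ideal.mul_mem_mul hb hc.1) ?_
    rw [mul_comm d]
    exact Ideal.mul_mem_mul ha.1 hd
  algebraMap_mem' c :=
    ⟨0, 1, c, IsSuperficial.one, by simp, (IsLocalization.mk'_one _ _).symm⟩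

/-- The `A`-submodule `A + 𝔪ⁱ A'` of the total ring of fractions. -/
def ringAddPow (i : ℕ) : Submodule A (FractionRing A) :=
  (1 : Submodule A (FractionRing A)) ⊔
    (maximalIdeal A ^ i) • Subalgebra.toSubmodule (firstNeighborhood A)

/-- The micro-invariants `βᵢ = λ((A + 𝔪ⁱ⁻¹A') / (A + 𝔪ⁱA')) - λ((A + 𝔪ⁱA') / (A + 𝔪ⁱ⁺¹A'))`
for `i ≥ 1`, and `β₀ = 1`. -/
def microInvariant : ℕ → ℤ
  | 0 => 1
  | i + 1 => (lengthQuot (ringAddPow A i) (ringAddPow A (i + 1)) : ℤ) -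
      lengthQuot (ringAddPow A (i + 1)) (ringAddPow A (i + 2))

variable {A}

/-- The Apery invariants `γᵢ = λ((𝔪ⁱ + xA) / (𝔪ⁱ⁺¹ + xA))`. -/
def aperyInvariant (x : A) (i : ℕ) : ℕ :=
  lengthQuot (maximalIdeal A ^ i ⊔ Ideal.span {x}) (maximalIdeal A ^ (i + 1) ⊔ Ideal.span {x})

variable (A) in
/-- The `A`-module `A' / A`. -/
abbrev NeighborhoodQuotient : Type u :=
  ↥(firstNeighborhood A) ⧸ LinearMap.range (Algebra.linearMap A ↥(firstNeighborhood A))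

/-- `σ` is (the inclusion of) a coefficient field of `A`: a ring homomorphism from the residue
field that splits the residue map. -/
def IsCoefficientField (σ : ResidueField A →+* A) : Prop :=
  (residue A).comp σ = RingHom.id (ResidueField A)

/-- `A' / A ≅ ⨁ᵢ K⟦X⟧ / (X^{nᵢ})` as `K⟦X⟧`-modules, where `A' / A` is a `K⟦X⟧`-module through a
ring homomorphism `ψ : K⟦X⟧ → A`. -/
def NeighborhoodQuotientIso (ψ : (ResidueField A)⟦X⟧ →+* A) {ι : Type} [Fintype ι] (n : ι → ℕ) :
    Prop :=
  ∃ φ : NeighborhoodQuotient A ≃+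
      (∀ i : ι, (ResidueField A)⟦X⟧ ⧸
        Ideal.span {(PowerSeries.X : (ResidueField A)⟦X⟧) ^ n i}),
    ∀ w y, φ (ψ w • y) = w • φ y

/-- If `A` is equicharacteristic and complete, then `A` has a coefficient field, and for every
coefficient field `K` of `A` there is an isomorphism of `K⟦X⟧`-modules
`A' / A ≅ ⨁ᵢ K⟦X⟧ / (X^{nᵢ})`, where `K⟦X⟧` acts through the homomorphism `K⟦X⟧ → A` that is the
inclusion on `K` and sends `X` to `x` (there is at most one, as `A` is `𝔪`-adically separated and
`x ∈ 𝔪`). -/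
def EquicharacteristicCompleteDecomposition (x : A) {ι : Type} [Fintype ι] (n : ι → ℕ) : Prop :=
  ringChar A = ringChar (ResidueField A) → IsAdicComplete (maximalIdeal A) A →
    (∃ σ : ResidueField A →+* A, IsCoefficientField σ) ∧
    ∀ σ : ResidueField A →+* A, IsCoefficientField σ →
      ∃ ψ : (ResidueField A)⟦X⟧ →+* A,
        ψ.comp (PowerSeries.C : ResidueField A →+* (ResidueField A)⟦X⟧) = σ ∧
        ψ PowerSeries.X = x ∧ NeighborhoodQuotientIso ψ n

end Neighborhood

/-- The members of a reduction of `𝔪` that is generated by `x` include `x`. -/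
theorem IsMinimalReduction.mem {A : Type*} [CommRing A] {x : A} {I : Ideal A}
    (h : IsMinimalReduction (Ideal.span {x}) I) : x ∈ I :=
  h.1.1 (Ideal.mem_span_singleton_self x)

end TangentCone

end

/-! Everything is read off from one notion, `IsFreeBasis`: elements yₛ ∈ 𝔪^{dₛ} such that in every
degree n the products x^{n-dₛ}yₛ with dₛ ≤ n induce a basis of 𝔪ⁿ/𝔪ⁿ⁺¹ over K. This is freeness of
G(𝔪) over K[x*] on the classes of the yₛ, phrased inside A.

Existence is a matter of lengths. Since x is regular, λ(A/xI) = λ(A/I) + λ(A/xA)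
(`length_span_mul`), and hence e = λ(A/xA) = λ(𝔪ⁿ/𝔪ⁿ⁺¹) for n ≥ r. If b = e, then x𝔪 ⊆ 𝔪² have the
same colength, so 𝔪² = x𝔪; only the degrees 0 and 1 remain to be checked (`IsFreeBasis.of_le`),
where 1 and e-1 elements completing x to a basis of 𝔪/𝔪² do the job. If b = 2, write 𝔪 = (x, y). A
dependence among the x^{n-i}yⁱ in degree n whose last unit coefficient sits at j bounds the Hilbert
function in large degrees by j (`multiplicity_le_of_mem`), which is absurd for n < e. So these
monomials are independent for n ≤ e-1, the Hilbert function is e at e-1, the length count gives 𝔪^e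
= x𝔪^{e-1}, and 1, y, …, y^{e-1} is a free basis.

Given a free basis, x* is a nonzerodivisor on G(𝔪), and each invariant of index i ≥ 1 counts the s
with dₛ = i. Modulo x only the yₛ with dₛ = i survive in degree i, which gives γᵢ and the Hilbert
series. Since A' = x^{-r}𝔪^r, the elements x^{i-dₛ}yₛ with dₛ > i induce a basis of (A + 𝔪ⁱA')/(A +
𝔪ⁱ⁺¹A'); taking differences gives βᵢ. Any decomposition of G(𝔪) has no torsion summands, and its
free generators come from another free basis, so αᵢ = γᵢ (`IsFreeBasis.eq_aperyInvariant`).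

Over a coefficient field, successive approximation shows that the yₛ/x^{dₛ} form a K⟦X⟧-basis of A'
and that the yₛ = X^{dₛ}(yₛ/x^{dₛ}) span A, whence A'/A. The coefficient field itself exists because
the residue field is formally smooth over its prime field, which is perfect. -/

noncomputable section

/-! ### Formal smoothness over perfect fields and coefficient fields -/

open Algebra in
/-- The kernel of the presentation of a formally smooth algebra by all of its elements. -/
theorem Algebra.FormallySmooth.mem_ker_sq {k L : Type*} [Field k] [Field L]
    [Algebra k L] [Algebra.FormallySmooth k L] (g : MvPolynomial L k)
    (hg : MvPolynomial.aeval (_root_.id : L → L) g = 0)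
    (hd : ∀ i, MvPolynomial.aeval (_root_.id : L → L) (MvPolynomial.pderiv i g) = 0) :
    g ∈ RingHom.ker (MvPolynomial.aeval (R := k) (_root_.id : L → L)) ^ 2 := by
  have hs := Algebra.FormallySmooth.subsingleton_h1Cotangent (R := k) (A := L)
  -- With I the kernel, vanishing of H₁ makes d : I/I² → ⨁ L dXᵢ injective, and `hd` says that dg =
  -- 0.
  rw [Algebra.H1Cotangent, Extension.subsingleton_h1Cotangent, injective_iff_map_eq_zero] at hs
  have := hs (Extension.Cotangent.mk ⟨g, hg⟩) (by
    rw [Extension.cotangentComplex_mk]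
    apply (Generators.self k L).cotangentSpaceBasis.repr.injective
    ext i
    rw [Generators.cotangentSpaceBasis_repr_one_tmul]
    rw [map_zero]
    exact hd i)
  rwa [Extension.Cotangent.mk_eq_zero_iff] at this

open Algebra in
/-- Every extension of a perfect field is formally smooth. -/
theorem Algebra.FormallySmooth.of_perfectField_of_field (k K : Type*) [Field k] [Field K]
    [Algebra k K] [PerfectField k] : Algebra.FormallySmooth k K := by
  refine ⟨inferInstance, ?_⟩
  rw [Algebra.H1Cotangent, Extension.subsingleton_h1Cotangent, injective_iff_map_eq_zero]
  intro z hz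
  obtain ⟨⟨f, hf⟩, rfl⟩ := Extension.Cotangent.mk_surjective z
  change MvPolynomial K k at f
  have hd : ∀ i, MvPolynomial.aeval (_root_.id : K → K) (MvPolynomial.pderiv i f) = 0 := by
    intro i
    have := (Generators.self k K).cotangentSpaceBasis_repr_one_tmul f i
    rw [Extension.cotangentComplex_mk] at hz
    erw [hz] at this
    rw [map_zero] at this
    exact this.symm
  have hf0 : MvPolynomial.aeval (_root_.id : K → K) f = 0 := hf
  rw [Extension.Cotangent.mk_eq_zero_iff]
  change f ∈ RingHom.ker (MvPolynomial.aeval (R := k) (_root_.id : K → K)) ^ 2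
  clear hz hf
  -- The variables are elements of K and only finitely many occur in f, so f descends to a finitely
  -- generated subextension, where formal smoothness over a perfect field is known.
  obtain ⟨L, hfL, hL⟩ : ∃ L : IntermediateField k K,
      (f.vars : Set K) ⊆ L ∧ Algebra.EssFiniteType k L :=
    ⟨IntermediateField.adjoin k (f.vars : Set K), IntermediateField.subset_adjoin k _,
      IntermediateField.essFiniteType_iff.2 ⟨f.vars, rfl⟩⟩
  obtain ⟨g, rfl⟩ := MvPolynomial.exists_rename_eq_of_vars_subset_range f (Subtype.val : L → K)
    Subtype.val_injective (by
      rwa [Subtype.range_coe])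
  have key : ∀ q : MvPolynomial L k,
      MvPolynomial.aeval (_root_.id : K → K) (MvPolynomial.rename (Subtype.val : L → K) q)
        = L.val (MvPolynomial.aeval (_root_.id : L → L) q) := by
    intro q
    rw [MvPolynomial.aeval_rename]
    exact (MvPolynomial.comp_aeval_apply (f := (_root_.id : L → L)) L.val q).symm
  have hg := Algebra.FormallySmooth.mem_ker_sq g
    (by rw [key] at hf0; exact (map_eq_zero L.val).1 hf0)
    (fun i => by
      have := hd i
      rw [MvPolynomial.pderiv_rename Subtype.val_injective, key] at this
      exact (map_eq_zero L.val).1 this)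
  have h2 := Ideal.mem_map_of_mem (MvPolynomial.rename (R := k) (Subtype.val : L → K)) hg
  rw [Ideal.map_pow] at h2
  refine Ideal.pow_right_mono (Ideal.map_le_iff_le_comap.2 fun q hq => ?_) 2 h2
  rw [Ideal.mem_comap, RingHom.mem_ker, key, (RingHom.mem_ker).1 hq, map_zero]

namespace TangentCone

/-- Formal smoothness of A/𝔪 over k lifts its identity map through the infinitesimal thickenings
A/𝔪ⁿ, and completeness assembles the lifts. -/
theorem exists_isCoefficientField_of_algebra {k A : Type*} [Field k] [PerfectField k] [CommRing A]
    [IsLocalRing A] [Algebra k A] [IsAdicComplete (maximalIdeal A) A] :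
    ∃ σ : ResidueField A →+* A, IsCoefficientField σ := by
  have := Algebra.FormallySmooth.of_perfectField_of_field k (ResidueField A)
  obtain ⟨g, hg⟩ := Algebra.FormallySmooth.exists_mkₐ_comp_eq_of_isAdicComplete
    (R := k) (A := ResidueField A) (S := A) (I := maximalIdeal A) (AlgHom.id k (ResidueField A))
  exact ⟨g, RingHom.ext fun a => congr($hg a)⟩

/-- A complete equicharacteristic local ring has a coefficient field. -/
theorem exists_isCoefficientField {A : Type*} [CommRing A]
    [IsLocalRing A] [IsAdicComplete (maximalIdeal A) A]
    (h : ringChar A = ringChar (ResidueField A)) :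
    ∃ σ : ResidueField A →+* A, IsCoefficientField σ := by
  obtain h0 | hp := CharP.char_is_prime_or_zero (ResidueField A) (ringChar (ResidueField A))
  · have : Fact (ringChar (ResidueField A)).Prime := ⟨h0⟩
    have hA : CharP A (ringChar (ResidueField A)) := h ▸ ringChar.charP A
    let := ZMod.algebra A (ringChar (ResidueField A))
    exact exists_isCoefficientField_of_algebra (k := ZMod (ringChar (ResidueField A)))
  · have hc : CharZero (ResidueField A) := by
      have := ringChar.charP (ResidueField A)
      rw [hp] at this
      exact CharP.charP_to_charZero _
    -- A contains ℚ as soon as all its proper quotients have characteristic zero; each of these maps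
    -- to the residue field.
    obtain ⟨hQ⟩ := (EqualCharZero.nonempty_algebraRat_iff A).2 (fun I hI => by
      refine ⟨fun a b hab => ?_⟩
      have := congrArg (Ideal.Quotient.factor (le_maximalIdeal hI)) hab
      rw [map_natCast, map_natCast] at this
      exact (Nat.cast_injective (R := ResidueField A)) this)
    exact exists_isCoefficientField_of_algebra (k := ℚ)

/-! ### Lengths of subquotients -/

section Length

variable {R M : Type*} [CommRing R] [AddCommGroup M] [Module R M]

theorem length_quotient_add {N N' : Submodule R M} (h : N' ≤ N) :
    Module.length R (M ⧸ N') =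
      Module.length R (↥N ⧸ N'.submoduleOf N) + Module.length R (M ⧸ N) := by
  refine Module.length_eq_add_of_exact
    (Submodule.mapQ (N'.submoduleOf N) N' N.subtype le_rfl)
    (Submodule.mapQ N' N LinearMap.id h) ?_ ?_ ?_
  · rw [injective_iff_map_eq_zero]
    intro z hz
    obtain ⟨z, rfl⟩ := Submodule.mkQ_surjective _ z
    exact (Submodule.Quotient.mk_eq_zero _).2
      ((Submodule.Quotient.mk_eq_zero N').1 hz : (z : M) ∈ N')
  · exact fun z => by
      obtain ⟨z, rfl⟩ := Submodule.mkQ_surjective _ z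
      exact ⟨Submodule.mkQ _ z, rfl⟩
  · intro z
    obtain ⟨z, rfl⟩ := Submodule.mkQ_surjective _ z
    simp only [Submodule.mkQ_apply, Submodule.mapQ_apply, LinearMap.id_apply,
      Submodule.Quotient.mk_eq_zero, Set.mem_range]
    constructor
    · intro hz
      exact ⟨Submodule.Quotient.mk ⟨z, hz⟩, rfl⟩
    · rintro ⟨w, hw⟩
      obtain ⟨w, rfl⟩ := Submodule.mkQ_surjective _ w
      have := (Submodule.Quotient.eq _).1 hw
      have h2 := N.sub_mem w.2 (h this)
      simpa using h2

/-- Additivity makes N/N' of length zero once the finite length of M/N is cancelled. Equalities of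
the form 𝔪ⁿ⁺¹ = x𝔪ⁿ are obtained in this way. -/
theorem eq_of_length_quotient_eq {N N' : Submodule R M} (h : N' ≤ N)
    (hfin : Module.length R (M ⧸ N) ≠ ⊤)
    (heq : Module.length R (M ⧸ N') = Module.length R (M ⧸ N)) : N' = N := by
  have h1 := length_quotient_add h
  rw [heq] at h1
  have h2 : Module.length R (↥N ⧸ N'.submoduleOf N) = 0 := by
    have : (0 : ℕ∞) + Module.length R (M ⧸ N) =
      Module.length R (↥N ⧸ N'.submoduleOf N) + Module.length R (M ⧸ N) := by rw [zero_add, ← h1]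
    exact (WithTop.add_right_cancel hfin this).symm
  rw [Module.length_eq_zero_iff, Submodule.Quotient.subsingleton_iff,
    Submodule.submoduleOf, Submodule.comap_subtype_eq_top] at h2
  exact le_antisymm h h2

variable [IsLocalRing R] {N N' : Submodule R M} {ι : Type*} [Fintype ι]

theorem length_pi_residueField :
    Module.length R (ι → R ⧸ maximalIdeal R) = Fintype.card ι := by
  have : IsSimpleModule R (R ⧸ maximalIdeal R) :=
    isSimpleModule_iff_isCoatom.2 (maximalIdeal.isMaximal R).out
  rw [Module.length_pi, Module.length_eq_one]
  simp

/-- The vₛ are killed by 𝔪 modulo N', so taking combinations factors through (R/𝔪)^ι. Surjectivity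
alone bounds the length; independence modulo 𝔪 turns the bound into an equality. -/
theorem exists_linearMap_ker_le_of_span (v : ι → M) (hv : ∀ s, v s ∈ N)
    (hm : ∀ s, ∀ a ∈ maximalIdeal R, a • v s ∈ N')
    (hspan : ∀ z ∈ N, ∃ c : ι → R, z - ∑ s, c s • v s ∈ N') :
    ∃ f : (ι → R ⧸ maximalIdeal R) →ₗ[R] (↥N ⧸ N'.submoduleOf N), Function.Surjective f ∧
      ∀ c : ι → R, (∑ s, c s • v s ∈ N') ↔ f (fun s => Ideal.Quotient.mk _ (c s)) = 0 := by
  let f : (ι → R ⧸ maximalIdeal R) →ₗ[R] (↥N ⧸ N'.submoduleOf N) :=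
    ∑ s, (Submodule.liftQ (maximalIdeal R)
      (LinearMap.toSpanSingleton R _ (Submodule.Quotient.mk ⟨v s, hv s⟩)) (by
        intro a ha
        rw [LinearMap.mem_ker, LinearMap.toSpanSingleton_apply, ← Submodule.Quotient.mk_smul,
          Submodule.Quotient.mk_eq_zero]
        exact hm s a ha)).comp (LinearMap.proj s)
  have hf : ∀ c : ι → R, f (fun s => Ideal.Quotient.mk _ (c s))
      = Submodule.Quotient.mk (∑ s, c s • ⟨v s, hv s⟩) := by
    intro c
    rw [LinearMap.sum_apply, ← Submodule.mkQ_apply, map_sum]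
    rfl
  refine ⟨f, ?_, ?_⟩
  · intro z
    obtain ⟨⟨z, hz⟩, rfl⟩ := Submodule.mkQ_surjective _ z
    obtain ⟨c, hc⟩ := hspan z hz
    refine ⟨fun s => Ideal.Quotient.mk _ (c s), ?_⟩
    rw [hf, Submodule.mkQ_apply, eq_comm, Submodule.Quotient.eq]
    simpa [Submodule.submoduleOf] using hc
  · intro c
    rw [hf, Submodule.Quotient.mk_eq_zero]
    simp [Submodule.submoduleOf]

theorem length_le_card (v : ι → M) (hv : ∀ s, v s ∈ N)
    (hm : ∀ s, ∀ a ∈ maximalIdeal R, a • v s ∈ N')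
    (hspan : ∀ z ∈ N, ∃ c : ι → R, z - ∑ s, c s • v s ∈ N') :
    Module.length R (↥N ⧸ N'.submoduleOf N) ≤ Fintype.card ι := by
  obtain ⟨f, hf, -⟩ := exists_linearMap_ker_le_of_span v hv hm hspan
  rw [← length_pi_residueField (R := R)]
  exact Module.length_le_of_surjective f hf

theorem length_eq_card (v : ι → M) (hv : ∀ s, v s ∈ N)
    (hm : ∀ s, ∀ a ∈ maximalIdeal R, a • v s ∈ N')
    (hspan : ∀ z ∈ N, ∃ c : ι → R, z - ∑ s, c s • v s ∈ N')
    (hind : ∀ c : ι → R, ∑ s, c s • v s ∈ N' → ∀ s, c s ∈ maximalIdeal R) :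
    Module.length R (↥N ⧸ N'.submoduleOf N) = Fintype.card ι := by
  obtain ⟨f, hf, hf'⟩ := exists_linearMap_ker_le_of_span v hv hm hspan
  rw [← length_pi_residueField (R := R)]
  refine (LinearEquiv.length_eq (LinearEquiv.ofBijective f ⟨?_, hf⟩)).symm
  rw [injective_iff_map_eq_zero]
  intro c hc
  choose c' hc' using fun s => Ideal.Quotient.mk_surjective (c s)
  obtain rfl : (fun s => Ideal.Quotient.mk _ (c' s)) = c := funext hc'
  funext s
  exact Ideal.Quotient.eq_zero_iff_mem.2 (hind c' ((hf' c').2 hc) s)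

theorem lengthQuot_eq_card (v : ι → M) (hv : ∀ s, v s ∈ N)
    (hm : ∀ s, ∀ a ∈ maximalIdeal R, a • v s ∈ N')
    (hspan : ∀ z ∈ N, ∃ c : ι → R, z - ∑ s, c s • v s ∈ N')
    (hind : ∀ c : ι → R, ∑ s, c s • v s ∈ N' → ∀ s, c s ∈ maximalIdeal R) :
    lengthQuot N N' = Fintype.card ι := by
  rw [lengthQuot, length_eq_card v hv hm hspan hind]
  simp

/-- The quotient is a finite-dimensional vector space over R/𝔪; lift a basis. -/
theorem exists_basis_mod (hN : N.FG) (hm : ∀ z ∈ N, ∀ a ∈ maximalIdeal R, a • z ∈ N') :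
    ∃ (n : ℕ) (v : Fin n → M), (∀ s, v s ∈ N) ∧
      (∀ z ∈ N, ∃ c : Fin n → R, z - ∑ s, c s • v s ∈ N') ∧
      ∀ c : Fin n → R, ∑ s, c s • v s ∈ N' → ∀ s, c s ∈ maximalIdeal R := by
  let Q := ↥N ⧸ N'.submoduleOf N
  have hQ : Module.IsTorsionBySet R Q (maximalIdeal R) := by
    rintro z ⟨a, ha⟩
    obtain ⟨⟨z, hz⟩, rfl⟩ := Submodule.mkQ_surjective _ z
    exact (Submodule.Quotient.mk_eq_zero _).2 (hm z hz a ha)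
  let := hQ.module
  let : Field (R ⧸ maximalIdeal R) := Ideal.Quotient.field _
  have : Module.Finite R N := Module.Finite.iff_fg.2 hN
  have : IsScalarTower R (R ⧸ maximalIdeal R) Q := hQ.isScalarTower
  have : Module.Finite (R ⧸ maximalIdeal R) Q := Module.Finite.of_restrictScalars_finite R _ _
  let b := Module.finBasis (R ⧸ maximalIdeal R) Q
  choose v hv using fun s => Submodule.mkQ_surjective _ (b s)
  have key : ∀ c : Fin (Module.finrank (R ⧸ maximalIdeal R) Q) → R,
      (Submodule.Quotient.mk (∑ s, c s • v s) : Q)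
        = ∑ s, (Ideal.Quotient.mk (maximalIdeal R) (c s)) • b s := by
    intro c
    rw [← Submodule.mkQ_apply, map_sum]
    refine Finset.sum_congr rfl fun s _ => ?_
    rw [map_smul, hv]
    exact (algebraMap_smul (R ⧸ maximalIdeal R) (c s) (b s)).symm
  refine ⟨_, fun s => (v s : M), fun s => (v s).2, ?_, ?_⟩
  · intro z hz
    choose c hc using fun s => Ideal.Quotient.mk_surjective
      (b.repr (Submodule.Quotient.mk ⟨z, hz⟩ : Q) s)
    refine ⟨c, ?_⟩
    have h1 := key c
    simp only [hc, b.sum_repr] at h1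
    have := (Submodule.Quotient.eq _).1 h1.symm
    simpa [Submodule.submoduleOf] using this
  · intro c hc
    have h1 := key c
    rw [(Submodule.Quotient.mk_eq_zero _).2 (by simpa [Submodule.submoduleOf] using hc)] at h1
    have h2 := Fintype.linearIndependent_iff.1 b.linearIndependent _ h1.symm
    exact fun s => Ideal.Quotient.eq_zero_iff_mem.1 (h2 s)

end Length

/-! ### Regularity of the minimal reduction and the multiplicity as a length -/

section Parameter

variable {A : Type u} [CommRing A] [IsLocalRing A]

/-- `x` is a regular element of `𝔪` with `𝔪ʳ⁺¹ = x 𝔪ʳ`. -/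
structure IsRegularReduction (x : A) (r : ℕ) : Prop where
  mem : x ∈ maximalIdeal A
  regular : ∀ z, x * z = 0 → z = 0
  pow_succ : maximalIdeal A ^ (r + 1) = Ideal.span {x} * maximalIdeal A ^ r

/-- Cohen-Macaulayness supplies a regular a ∈ 𝔪. As aⁿ⁺¹ ∈ 𝔪ⁿ⁺¹ = x𝔪ⁿ is a multiple of x, whatever x
kills is killed by aⁿ⁺¹. -/
theorem isRegularReduction_of_isMinimalReduction
    (hCM : IsCohenMacaulayLocal A) (hdim : ringKrullDim A = 1) {x : A}
    (hx : IsMinimalReduction (Ideal.span {x}) (maximalIdeal A)) :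
    IsRegularReduction x (reductionNumber x) := by
  obtain ⟨hle, n, hn⟩ := hx.1
  refine ⟨hx.mem, ?_, Nat.sInf_mem (s := {r | maximalIdeal A ^ (r + 1) =
    Ideal.span {x} * maximalIdeal A ^ r}) ⟨n, hn⟩⟩
  obtain ⟨rs, hmem, hreg, hlen⟩ := hCM
  rw [hdim] at hlen
  have hlen1 : rs.length = 1 := by
    have : ((rs.length : ℕ∞) : WithBot ℕ∞) = ((1 : ℕ) : ℕ∞) := hlen
    exact Nat.cast_injective (WithBot.coe_injective this)
  obtain ⟨a, rfl⟩ := List.length_eq_one_iff.1 hlen1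
  have ha : IsSMulRegular A a :=
    (RingTheory.Sequence.isWeaklyRegular_singleton_iff A a).1 hreg.toIsWeaklyRegular
  have ham : a ^ (n + 1) ∈ Ideal.span {x} * maximalIdeal A ^ n := by
    rw [← hn]
    exact Ideal.pow_mem_pow (hmem a (by simp)) _
  obtain ⟨c, hc⟩ := Ideal.mem_span_singleton'.1
    ((Ideal.mul_le_left : Ideal.span {x} * maximalIdeal A ^ n ≤ _) ham)
  intro z hz
  refine (ha.pow (n + 1)).right_eq_zero_of_smul ?_
  rw [smul_eq_mul, ← hc, mul_assoc, hz, mul_zero]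

namespace IsRegularReduction

variable {x : A} {r : ℕ} (h : IsRegularReduction x r)

include h

theorem mem_nonZeroDivisors : x ∈ nonZeroDivisors A :=
  mem_nonZeroDivisors_iff_right.2 fun z hz => h.regular z (by rwa [mul_comm])

theorem cancel_pow {n : ℕ} {a b : A} (hab : x ^ n * a = x ^ n * b) : a = b :=
  (mul_cancel_left_mem_nonZeroDivisors (pow_mem h.mem_nonZeroDivisors n)).1 hab

theorem pow_eq {n : ℕ} (hn : r ≤ n) :
    maximalIdeal A ^ (n + 1) = Ideal.span {x} * maximalIdeal A ^ n := by
  obtain ⟨k, rfl⟩ := Nat.exists_eq_add_of_le hn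
  rw [add_right_comm, pow_add, h.pow_succ, mul_assoc, ← pow_add]

theorem pow_eq_pow_mul (k : ℕ) {n : ℕ} (hn : r ≤ n) :
    maximalIdeal A ^ (n + k) = Ideal.span {x ^ k} * maximalIdeal A ^ n := by
  induction k with
  | zero => simp
  | succ k ih =>
    rw [← add_assoc, h.pow_eq (hn.trans (Nat.le_add_right n k)), ih, ← mul_assoc,
      Ideal.span_singleton_mul_span_singleton, pow_succ']

theorem exists_eq_pow_mul {k n : ℕ} (hn : r ≤ n) {a : A} (ha : a ∈ maximalIdeal A ^ (n + k)) :
    ∃ b ∈ maximalIdeal A ^ n, a = x ^ k * b := by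
  rw [h.pow_eq_pow_mul k hn] at ha
  obtain ⟨b, hb, rfl⟩ := Ideal.mem_span_singleton_mul.1 ha
  exact ⟨b, hb, rfl⟩

theorem mem_of_pow_mul_mem {k n : ℕ} (hn : r ≤ n) {a : A}
    (ha : x ^ k * a ∈ maximalIdeal A ^ (n + k)) : a ∈ maximalIdeal A ^ n := by
  obtain ⟨b, hb, hab⟩ := h.exists_eq_pow_mul hn ha
  rwa [h.cancel_pow hab]

theorem pow_mul_mem (k : ℕ) {n : ℕ} {a : A} (ha : a ∈ maximalIdeal A ^ n) :
    x ^ k * a ∈ maximalIdeal A ^ (n + k) := by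
  rw [add_comm, pow_add]
  exact Ideal.mul_mem_mul (Ideal.pow_mem_pow h.mem k) ha

theorem pow_ne_zero_ideal (n : ℕ) : maximalIdeal A ^ n ≠ ⊥ := fun hn => by
  have h1 : x ^ n = 0 := by simpa [hn] using Ideal.pow_mem_pow h.mem n
  exact one_ne_zero (h.cancel_pow (n := n) (a := 1) (b := 0) (by simp [h1]))

/-- Otherwise 𝔪ʳ⁺¹ = x𝔪ʳ ⊆ 𝔪ʳ⁺², so 𝔪ʳ⁺¹ = 0 by Nakayama, although xʳ⁺¹ ≠ 0. -/
theorem notMem_sq [IsNoetherianRing A] : x ∉ maximalIdeal A ^ 2 := fun hx => by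
  apply h.pow_ne_zero_ideal (r + 1)
  apply Submodule.eq_bot_of_le_smul_of_le_jacobson_bot (maximalIdeal A) _
    (IsNoetherian.noetherian _) ?_ (maximalIdeal_le_jacobson _)
  rw [smul_eq_mul, ← _root_.pow_succ', h.pow_succ]
  refine (Ideal.mul_mono_left ((Ideal.span_singleton_le_iff_mem _).2 hx)).trans ?_
  rw [← pow_add, add_comm]

/-- Multiplication by the regular element x gives the exact sequence 0 → A/I → A/xI → A/xA → 0. -/
theorem length_span_mul (I : Ideal A) :
    Module.length A (A ⧸ Ideal.span {x} * I) =
      Module.length A (A ⧸ I) + Module.length A (A ⧸ Ideal.span {x}) := by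
  refine Module.length_eq_add_of_exact
    (Submodule.mapQ I (Ideal.span {x} * I) (LinearMap.mulLeft A x) ?_)
    (Submodule.mapQ (Ideal.span {x} * I) (Ideal.span {x}) LinearMap.id
      (Ideal.mul_le_left : Ideal.span {x} * I ≤ Ideal.span {x})) ?_ ?_ ?_
  · intro a ha
    exact Ideal.mul_mem_mul (Ideal.mem_span_singleton_self x) ha
  · rw [injective_iff_map_eq_zero]
    intro z hz
    obtain ⟨z, rfl⟩ := Submodule.mkQ_surjective _ z
    have hz' : x * z ∈ Ideal.span {x} * I := (Submodule.Quotient.mk_eq_zero _).1 hz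
    obtain ⟨b, hb, hb'⟩ := Ideal.mem_span_singleton_mul.1 hz'
    refine (Submodule.Quotient.mk_eq_zero _).2 ?_
    rwa [← h.cancel_pow (n := 1) (a := b) (b := z) (by simpa using hb')]
  · intro z
    obtain ⟨z, rfl⟩ := Submodule.mkQ_surjective _ z
    exact ⟨Submodule.mkQ _ z, rfl⟩
  · intro z
    obtain ⟨z, rfl⟩ := Submodule.mkQ_surjective _ z
    simp only [Submodule.mkQ_apply, Submodule.mapQ_apply, LinearMap.id_apply,
      Submodule.Quotient.mk_eq_zero, Set.mem_range]
    constructor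
    · intro hz
      obtain ⟨w, rfl⟩ := Ideal.mem_span_singleton.1 hz
      exact ⟨Submodule.Quotient.mk w, rfl⟩
    · rintro ⟨w, hw⟩
      obtain ⟨w, rfl⟩ := Submodule.mkQ_surjective _ w
      have h1 : x * w - z ∈ Ideal.span {x} * I := (Submodule.Quotient.eq _).1 hw
      have h2 := Ideal.sub_mem _ (Ideal.mul_mem_right w _ (Ideal.mem_span_singleton_self x))
        (Ideal.mul_le_left h1)
      simpa using h2

end IsRegularReduction

theorem length_pow_quotient_ne_top [IsNoetherianRing A] (n : ℕ) :
    Module.length A (A ⧸ maximalIdeal A ^ n) ≠ ⊤ := by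
  induction n with
  | zero =>
    have : Subsingleton (A ⧸ maximalIdeal A ^ 0) := by simp
    rw [Module.length_eq_zero]
    simp
  | succ n ih =>
    have hm : ∀ z ∈ maximalIdeal A ^ n, ∀ a ∈ maximalIdeal A,
        a • z ∈ maximalIdeal A ^ (n + 1) := fun z hz a ha => by
      rw [pow_succ']
      exact Ideal.mul_mem_mul ha hz
    rw [length_quotient_add (Ideal.pow_le_pow_right n.le_succ)]
    obtain ⟨k, v, hv, hspan, -⟩ := exists_basis_mod (IsNoetherian.noetherian _) hm
    have := length_le_card v hv (fun s => hm _ (hv s)) hspan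
    exact WithTop.add_ne_top.2 ⟨ne_top_of_le_ne_top (ENat.natCast_ne_top _) this, ih⟩

theorem coe_lengthQuot {R M : Type*} [CommRing R] [AddCommGroup M] [Module R M]
    {N N' : Submodule R M} (h : N' ≤ N) (hfin : Module.length R (M ⧸ N') ≠ ⊤) :
    Module.length R (M ⧸ N') = lengthQuot N N' + Module.length R (M ⧸ N) := by
  rw [length_quotient_add h] at hfin ⊢
  rw [lengthQuot, ENat.natCast_toNat]
  exact (WithTop.add_ne_top.1 hfin).1

theorem length_quotient_pow_succ [IsNoetherianRing A] (n : ℕ) :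
    Module.length A (A ⧸ maximalIdeal A ^ (n + 1)) =
      hilbertFunction (maximalIdeal A) n + Module.length A (A ⧸ maximalIdeal A ^ n) :=
  coe_lengthQuot (Ideal.pow_le_pow_right n.le_succ) (length_pow_quotient_ne_top _)

namespace IsRegularReduction

variable {x : A} {r : ℕ} (h : IsRegularReduction x r)

include h

/-- Here 𝔪ⁿ⁺¹ = x𝔪ⁿ, so λ(A/𝔪ⁿ⁺¹) - λ(A/𝔪ⁿ) = λ(A/xA) by `length_span_mul`. -/
theorem hilbertFunction_eq [IsNoetherianRing A] {n : ℕ} (hn : r ≤ n) :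
    (hilbertFunction (maximalIdeal A) n : ℕ∞) = Module.length A (A ⧸ Ideal.span {x}) := by
  have h1 := h.length_span_mul (maximalIdeal A ^ n)
  rw [← h.pow_eq hn, length_quotient_pow_succ, add_comm] at h1
  exact WithTop.add_left_cancel (length_pow_quotient_ne_top _) h1

theorem isMultiplicity [IsNoetherianRing A] : IsMultiplicity A (hilbertFunction (maximalIdeal A) r) := by
  -- The formula at n = r forces this ρ; from there on the Hilbert function is constant.
  refine ⟨hilbertFunction (maximalIdeal A) r * (r + 1) - hilbertSamuel A r,
    Filter.eventually_atTop.2 ⟨r, fun n hn => ?_⟩⟩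
  induction n, hn using Nat.le_induction with
  | base => ring
  | succ n hn ih =>
    have h1 : hilbertFunction (maximalIdeal A) (n + 1) = hilbertFunction (maximalIdeal A) r := by
      have := (h.hilbertFunction_eq (hn.trans n.le_succ)).trans (h.hilbertFunction_eq le_rfl).symm
      exact_mod_cast this
    have h2 : hilbertSamuel A (n + 1) = hilbertSamuel A n + hilbertFunction (maximalIdeal A) r := by
      rw [hilbertSamuel, Finset.sum_range_succ, h1, hilbertSamuel]
    rw [h2]
    push_cast
    rw [ih]
    ring

theorem hilbertFunction_eq_multiplicity [IsNoetherianRing A] {n : ℕ} (hn : r ≤ n) :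
    hilbertFunction (maximalIdeal A) n = multiplicity A := by
  rw [h.isMultiplicity.multiplicity_eq]
  have := (h.hilbertFunction_eq hn).trans (h.hilbertFunction_eq le_rfl).symm
  exact_mod_cast this

theorem length_eq_multiplicity [IsNoetherianRing A] :
    Module.length A (A ⧸ Ideal.span {x}) = multiplicity A := by
  rw [← h.hilbertFunction_eq le_rfl, h.hilbertFunction_eq_multiplicity le_rfl]

end IsRegularReduction

end Parameter

/-! ### Free bases of the tangent cone; the case of minimal multiplicity -/

section FreeBasis

variable {A : Type u} [CommRing A] [IsLocalRing A] {ι : Type*} [Fintype ι]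

/-- The element `∑ cₛ xⁿ⁻ᵈ⁽ˢ⁾ yₛ`, the sum being over the `s` with `d s ≤ n`. -/
def shiftedSum (x : A) (d : ι → ℕ) (y : ι → A) (n : ℕ) (c : ι → A) : A :=
  ∑ s, if d s ≤ n then c s * (x ^ (n - d s) * y s) else 0

/-- The initial forms of the `yₛ` in the degrees `d s` are a basis of `G(𝔪)` over `K[x*]`: for each
`n` the elements `xⁿ⁻ᵈ⁽ˢ⁾ yₛ` with `d s ≤ n` induce a basis of `𝔪ⁿ / 𝔪ⁿ⁺¹`. -/
structure IsFreeBasis (x : A) (d : ι → ℕ) (y : ι → A) : Prop where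
  mem : ∀ s, y s ∈ maximalIdeal A ^ d s
  span : ∀ n, ∀ a ∈ maximalIdeal A ^ n, ∃ c, a - shiftedSum x d y n c ∈ maximalIdeal A ^ (n + 1)
  indep : ∀ n c, shiftedSum x d y n c ∈ maximalIdeal A ^ (n + 1) →
    ∀ s, d s ≤ n → c s ∈ maximalIdeal A

omit [IsLocalRing A] in
theorem shiftedSum_add {x : A} {d : ι → ℕ} {y : ι → A} {n : ℕ} (hd : ∀ s, d s ≤ n) (k : ℕ)
    (c : ι → A) : shiftedSum x d y (n + k) c = x ^ k * shiftedSum x d y n c := by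
  rw [shiftedSum, shiftedSum, Finset.mul_sum]
  refine Finset.sum_congr rfl fun s _ => ?_
  rw [if_pos (hd s), if_pos ((hd s).trans (Nat.le_add_right n k)),
    show n + k - d s = (n - d s) + k by have := hd s; omega, pow_add]
  ring

/-- Freeness has to be checked only up to a degree that bounds the reduction number and the degrees
of the generators. -/
theorem IsFreeBasis.of_le {x : A} {r : ℕ} (h : IsRegularReduction x r) {d : ι → ℕ} {y : ι → A}
    {N : ℕ} (hN : r ≤ N) (hd : ∀ s, d s ≤ N) (mem : ∀ s, y s ∈ maximalIdeal A ^ d s)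
    (span : ∀ n ≤ N, ∀ a ∈ maximalIdeal A ^ n,
      ∃ c, a - shiftedSum x d y n c ∈ maximalIdeal A ^ (n + 1))
    (indep : ∀ n ≤ N, ∀ c, shiftedSum x d y n c ∈ maximalIdeal A ^ (n + 1) →
      ∀ s, d s ≤ n → c s ∈ maximalIdeal A) : IsFreeBasis x d y := by
  refine ⟨mem, fun n a ha => ?_, fun n c hc s hs => ?_⟩
  · obtain hn | hn := le_total n N
    · exact span n hn a ha
    -- Above N multiplication by xᵏ identifies 𝔪ᴺ with 𝔪ᴺ⁺ᵏ and 𝔪ᴺ⁺¹ with 𝔪ᴺ⁺ᵏ⁺¹, and all generators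
    -- already occur in degree N.
    · obtain ⟨k, rfl⟩ := Nat.exists_eq_add_of_le hn
      obtain ⟨b, hb, rfl⟩ := h.exists_eq_pow_mul hN ha
      obtain ⟨c, hc⟩ := span N le_rfl b hb
      refine ⟨c, ?_⟩
      rw [shiftedSum_add hd, ← mul_sub, add_right_comm]
      exact h.pow_mul_mem k hc
  · obtain hn | hn := le_total n N
    · exact indep n hn c hc s hs
    · obtain ⟨k, rfl⟩ := Nat.exists_eq_add_of_le hn
      rw [shiftedSum_add hd, add_right_comm] at hc
      exact indep N le_rfl c (h.mem_of_pow_mul_mem (hN.trans N.le_succ) hc) s (hd s)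

/-- Lifts to `𝔪` of a basis of `𝔪 / (𝔪² + xA)` form together with `x` a basis of `𝔪 / 𝔪²`. -/
theorem exists_basis_with [IsNoetherianRing A] {x : A} {r : ℕ} (h : IsRegularReduction x r) :
    ∃ (n : ℕ) (y : Fin n → A), embDim A = n + 1 ∧ (∀ s, y s ∈ maximalIdeal A) ∧
      (∀ a ∈ maximalIdeal A, ∃ (b : A) (c : Fin n → A),
        a - (b * x + ∑ s, c s * y s) ∈ maximalIdeal A ^ 2) ∧
      ∀ (b : A) (c : Fin n → A), b * x + ∑ s, c s * y s ∈ maximalIdeal A ^ 2 →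
        b ∈ maximalIdeal A ∧ ∀ s, c s ∈ maximalIdeal A := by
  have hm : ∀ z ∈ maximalIdeal A, ∀ a ∈ maximalIdeal A, a • z ∈ maximalIdeal A ^ 2 :=
    fun z hz a ha => by rw [pow_two]; exact Ideal.mul_mem_mul ha hz
  obtain ⟨n, y, hy, hspan, hind⟩ := exists_basis_mod (N := maximalIdeal A)
    (N' := Ideal.span {x} ⊔ maximalIdeal A ^ 2) (IsNoetherian.noetherian _)
    (fun z hz a ha => Submodule.mem_sup_right (hm z hz a ha))
  have hspan' : ∀ a ∈ maximalIdeal A, ∃ (b : A) (c : Fin n → A),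
      a - (b * x + ∑ s, c s * y s) ∈ maximalIdeal A ^ 2 := by
    intro a ha
    obtain ⟨c, hc⟩ := hspan a ha
    obtain ⟨u, hu, w, hw, huw⟩ := Submodule.mem_sup.1 hc
    obtain ⟨b, rfl⟩ := Ideal.mem_span_singleton'.1 hu
    refine ⟨b, c, ?_⟩
    have : a - (b * x + ∑ s, c s * y s) = w := by
      simp only [smul_eq_mul] at huw
      linear_combination -huw
    rwa [this]
  have hind' : ∀ (b : A) (c : Fin n → A), b * x + ∑ s, c s * y s ∈ maximalIdeal A ^ 2 →
        b ∈ maximalIdeal A ∧ ∀ s, c s ∈ maximalIdeal A := by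
    intro b c hbc
    have hc : ∀ s, c s ∈ maximalIdeal A := by
      refine hind c ?_
      have : ∑ s, c s • y s = (-b) * x + (b * x + ∑ s, c s * y s) := by
        simp only [smul_eq_mul]; ring
      rw [this]
      exact Submodule.add_mem_sup (Ideal.mul_mem_left _ _ (Ideal.mem_span_singleton_self x)) hbc
    refine ⟨?_, hc⟩
    -- With all c s in 𝔪 the y-part lies in 𝔪², so a unit b would force x ∈ 𝔪².
    by_contra hb
    obtain ⟨u, rfl⟩ := not_not.1 ((mem_nonunits_iff).not.1 hb)
    have h1 : ∑ s, c s * y s ∈ maximalIdeal A ^ 2 :=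
      Ideal.sum_mem _ fun s _ => hm _ (hy s) _ (hc s)
    have h2 : u * x ∈ maximalIdeal A ^ 2 := by
      simpa using Ideal.sub_mem _ hbc h1
    apply h.notMem_sq
    simpa using Ideal.mul_mem_left _ (↑u⁻¹ : A) h2
  refine ⟨n, y, ?_, hy, hspan', hind'⟩
  rw [embDim, lengthQuot_eq_card (ι := Option (Fin n)) (fun o => o.elim x y)]
  · simp
  · rintro (_ | s)
    exacts [h.mem, hy s]
  · rintro (_ | s) a ha
    exacts [hm _ h.mem _ ha, hm _ (hy s) _ ha]
  · intro z hz
    obtain ⟨b, c, hc⟩ := hspan' z hz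
    exact ⟨fun o => o.elim b c, by simpa using hc⟩
  · intro c hc
    obtain ⟨h1, h2⟩ := hind' (c none) (fun s => c (some s)) (by simpa using hc)
    rintro (_ | s)
    exacts [h1, h2 s]

theorem multiplicity_pos [IsNoetherianRing A] {x : A} {r : ℕ} (h : IsRegularReduction x r) :
    0 < multiplicity A := by
  rw [Nat.pos_iff_ne_zero]
  intro h0
  have := h.length_eq_multiplicity
  rw [h0, Nat.cast_zero, Module.length_eq_zero_iff, Submodule.Quotient.subsingleton_iff] at this
  exact (maximalIdeal.isMaximal A).ne_top
    (top_le_iff.1 (this ▸ (Ideal.span_singleton_le_iff_mem _).2 h.mem))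

/-- A local ring of minimal multiplicity has reduction number at most `1`. -/
theorem isRegularReduction_one [IsNoetherianRing A] {x : A} {r : ℕ} (h : IsRegularReduction x r)
    (hb : embDim A = multiplicity A) : IsRegularReduction x 1 := by
  refine ⟨h.mem, h.regular, ?_⟩
  -- Compare λ(A/x𝔪) = λ(A/𝔪) + e with λ(A/𝔪²) = λ(A/𝔪) + b.
  have h1 := h.length_span_mul (maximalIdeal A ^ 1)
  rw [h.length_eq_multiplicity, ← hb] at h1
  have h2 := length_quotient_pow_succ (A := A) 1
  have h3 : hilbertFunction (maximalIdeal A) 1 = embDim A := by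
    rw [hilbertFunction, embDim, pow_one]
  rw [h3] at h2
  refine (eq_of_length_quotient_eq ?_ (length_pow_quotient_ne_top _) ?_).symm
  · rw [pow_succ' _ 1]
    exact Ideal.mul_mono_left ((Ideal.span_singleton_le_iff_mem _).2 h.mem)
  · rw [h1, h2, add_comm]

/-- Since 𝔪² = x𝔪, only the degrees 0 and 1 have to be checked. The generators are 1 in degree 0
and, in degree 1, the elements completing x to a basis of 𝔪/𝔪². -/
theorem exists_isFreeBasis_of_minimal_multiplicity [IsNoetherianRing A] {x : A} {r : ℕ}
    (h : IsRegularReduction x r) (hb : embDim A = multiplicity A) :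
    ∃ y : Fin 1 ⊕ Fin (multiplicity A - 1) → A,
      IsFreeBasis x (Sum.elim (fun _ => 0) (fun _ => 1)) y := by
  obtain ⟨n, y, hn, hy, hspan, hind⟩ := exists_basis_with h
  obtain rfl : n = multiplicity A - 1 := by omega
  have key : ∀ c, shiftedSum x (Sum.elim (fun _ : Fin 1 => 0) (fun _ => 1)) (Sum.elim (fun _ => 1) y) 1 c
      = c (Sum.inl 0) * x + ∑ s, c (Sum.inr s) * y s := by
    intro c
    simp [shiftedSum]
  refine ⟨Sum.elim (fun _ => 1) y,
    IsFreeBasis.of_le (isRegularReduction_one h hb) le_rfl ?_ ?_ ?_ ?_⟩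
  · rintro (s | s) <;> simp
  · rintro (s | s)
    · simp
    · simpa using hy s
  · intro k hk a ha
    obtain rfl | rfl := Nat.le_one_iff_eq_zero_or_eq_one.1 hk
    · exact ⟨fun _ => a, by simp [shiftedSum]⟩
    · obtain ⟨b, c, hc⟩ := hspan a (by simpa using ha)
      refine ⟨Sum.elim (fun _ => b) c, ?_⟩
      rw [key]
      exact hc
  · intro k hk c hc
    obtain rfl | rfl := Nat.le_one_iff_eq_zero_or_eq_one.1 hk
    · rintro (s | s) hs
      · rw [Subsingleton.elim s 0]
        simpa [shiftedSum] using hc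
      · simp at hs
    · rw [key] at hc
      obtain ⟨h1, h2⟩ := hind _ _ hc
      rintro (s | s) hs
      · rw [Subsingleton.elim s 0]
        exact h1
      · exact h2 s

end FreeBasis

/-! ### Embedding dimension two: powers of y as a free basis -/

section EmbDimTwo

variable {A : Type u} [CommRing A]

theorem exists_sum_of_mem_span_pair_pow {x y : A} {n : ℕ} {a : A}
    (ha : a ∈ Ideal.span {x, y} ^ n) :
    ∃ c : ℕ → A, a = ∑ i ∈ Finset.range (n + 1), c i * (x ^ (n - i) * y ^ i) := by
  induction n generalizing a with
  | zero => exact ⟨fun _ => a, by simp⟩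
  | succ n ih =>
    rw [pow_succ'] at ha
    refine Submodule.mul_induction_on ha ?_ ?_
    · intro u hu b hb
      obtain ⟨p, q, rfl⟩ := Ideal.mem_span_pair.1 hu
      obtain ⟨c, rfl⟩ := ih hb
      -- The coefficients of (px + qy)∑cᵢxⁿ⁻ⁱyⁱ; the guards remove the undefined terms at both ends.
      refine ⟨fun i => (if i ≤ n then p * c i else 0) + (if 1 ≤ i then q * c (i - 1) else 0), ?_⟩
      simp only [add_mul, Finset.sum_add_distrib]
      congr 1
      · rw [Finset.sum_range_succ _ (n + 1), if_neg (by omega), zero_mul, add_zero, Finset.mul_sum]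
        refine Finset.sum_congr rfl fun i hi => ?_
        have hi' := Finset.mem_range.1 hi
        rw [if_pos (by omega), show n + 1 - i = (n - i) + 1 by omega]
        ring
      · rw [Finset.sum_range_succ' _ (n + 1), if_neg (by omega), zero_mul, add_zero, Finset.mul_sum]
        refine Finset.sum_congr rfl fun i hi => ?_
        rw [if_pos (by omega), Nat.add_sub_cancel, show n + 1 - (i + 1) = n - i by omega]
        ring
    · rintro a b ⟨c, rfl⟩ ⟨c', rfl⟩
      exact ⟨fun i => c i + c' i, by simp only [add_mul, Finset.sum_add_distrib]⟩

variable [IsLocalRing A] {x y : A} {r : ℕ}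

theorem sum_pow_mul_pow_mem (hm : maximalIdeal A = Ideal.span {x, y}) {n : ℕ} (i : ℕ) (hi : i ≤ n) :
    x ^ (n - i) * y ^ i ∈ maximalIdeal A ^ n := by
  have hx : x ∈ maximalIdeal A := hm ▸ Ideal.subset_span (by simp)
  have hy : y ∈ maximalIdeal A := hm ▸ Ideal.subset_span (by simp)
  have := Ideal.mul_mem_mul (Ideal.pow_mem_pow hx (n - i)) (Ideal.pow_mem_pow hy i)
  rwa [← pow_add, Nat.sub_add_cancel hi] at this

/-- If `xⁿ⁻ʲ yʲ` is modulo `𝔪ⁿ⁺¹` a combination of the `xⁿ⁻ⁱ yⁱ` with `i < j`, then the multiplicity is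
at most `j`. -/
theorem multiplicity_le_of_mem [IsNoetherianRing A] (h : IsRegularReduction x r)
    (hm : maximalIdeal A = Ideal.span {x, y}) {n j : ℕ} (hj : j ≤ n)
    (hrel : x ^ (n - j) * y ^ j ∈
      Ideal.span (Set.range fun i : Fin j => x ^ (n - i) * y ^ (i : ℕ)) ⊔ maximalIdeal A ^ (n + 1)) :
    multiplicity A ≤ j := by
  obtain ⟨b, hb, w, hw, hbw⟩ := Submodule.mem_sup.1 hrel
  obtain ⟨b, rfl⟩ := Ideal.mem_span_range_iff_exists_fun.1 hb
  -- The relation is used as a rewriting rule that lowers the exponent of y below j. The bound on i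
  -- guarantees that the factor xⁿ⁻ʲ it needs is present.
  have hred : ∀ L i : ℕ, i + (n - j) ≤ L → x ^ (L - i) * y ^ i ∈
      Ideal.span (Set.range fun i : Fin j => x ^ (L - i) * y ^ (i : ℕ)) ⊔
        maximalIdeal A ^ (L + 1) := by
    intro L i
    induction i using Nat.strong_induction_on with
    | _ i ih =>
      intro hi
      obtain hij | hij := lt_or_ge i j
      · exact Submodule.mem_sup_left (Ideal.subset_span ⟨⟨i, hij⟩, rfl⟩)
      · have e : x ^ (L - i) * y ^ i
            = x ^ (L - i - (n - j)) * y ^ (i - j) * (x ^ (n - j) * y ^ j) := by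
          rw [mul_mul_mul_comm, ← pow_add, ← pow_add]
          congr 2 <;> omega
        rw [e, ← hbw, mul_add, Finset.mul_sum]
        refine Ideal.add_mem _ (Ideal.sum_mem _ fun k _ => ?_) (Submodule.mem_sup_right ?_)
        · have hk := k.2
          have e2 : x ^ (L - i - (n - j)) * y ^ (i - j) * (b k * (x ^ (n - k) * y ^ (k : ℕ)))
              = b k * (x ^ (L - (i - j + k)) * y ^ (i - j + k)) := by
            rw [show L - (i - j + k) = (L - i - (n - j)) + (n - k) by omega, pow_add, pow_add]
            ring
          rw [e2]
          exact Ideal.mul_mem_left _ _ (ih _ (by omega) (by omega))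
        · have h1 := sum_pow_mul_pow_mem hm (n := L - n) (i - j) (by omega)
          rw [show L - n - (i - j) = L - i - (n - j) by omega] at h1
          have h2 := Ideal.mul_mem_mul h1 hw
          rwa [← pow_add, show L - n + (n + 1) = L + 1 by omega] at h2
  -- In degree r + n one has 𝔪ʳ⁺ⁿ = xⁿ𝔪ʳ, so the exponents of y needed are at most r and every
  -- generator can be rewritten; j generators remain.
  have hL : hilbertFunction (maximalIdeal A) (r + n) = multiplicity A :=
    h.hilbertFunction_eq_multiplicity (Nat.le_add_right r n)
  have hle : (hilbertFunction (maximalIdeal A) (r + n) : ℕ∞) ≤ Fintype.card (Fin j) := by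
    rw [hilbertFunction, lengthQuot]
    refine (ENat.natCast_toNat_le_self _).trans
      (length_le_card (fun i : Fin j => x ^ (r + n - i) * y ^ (i : ℕ)) ?_ ?_ ?_)
    · exact fun s => sum_pow_mul_pow_mem hm _ (by have := s.2; omega)
    · intro s a ha
      rw [pow_succ']
      exact Ideal.mul_mem_mul ha (sum_pow_mul_pow_mem hm _ (by have := s.2; omega))
    · intro z hz
      obtain ⟨z, hz', rfl⟩ := h.exists_eq_pow_mul le_rfl hz
      rw [hm] at hz'
      obtain ⟨c, rfl⟩ := exists_sum_of_mem_span_pair_pow hz'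
      have : x ^ n * ∑ i ∈ Finset.range (r + 1), c i * (x ^ (r - i) * y ^ i) ∈
          Ideal.span (Set.range fun i : Fin j => x ^ (r + n - i) * y ^ (i : ℕ)) ⊔
            maximalIdeal A ^ (r + n + 1) := by
        rw [Finset.mul_sum]
        refine Ideal.sum_mem _ fun i hi => ?_
        have hi' := Finset.mem_range.1 hi
        have e : x ^ n * (c i * (x ^ (r - i) * y ^ i)) = c i * (x ^ (r + n - i) * y ^ i) := by
          rw [show r + n - i = (r - i) + n by omega, pow_add]
          ring
        rw [e]
        exact Ideal.mul_mem_left _ _ (hred _ _ (by omega))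
      obtain ⟨u, hu, v, hv, huv⟩ := Submodule.mem_sup.1 this
      obtain ⟨c', rfl⟩ := Ideal.mem_span_range_iff_exists_fun.1 hu
      refine ⟨c', ?_⟩
      rw [← huv]
      simpa using hv
  rw [hL, Fintype.card_fin] at hle
  exact_mod_cast hle

/-- At the largest j with c j a unit, the later terms lie in 𝔪ⁿ⁺¹. Dividing by c j yields the
relation of `multiplicity_le_of_mem`, so e ≤ j ≤ n, a contradiction. -/
theorem coeff_mem_of_sum_mem [IsNoetherianRing A] (h : IsRegularReduction x r)
    (hm : maximalIdeal A = Ideal.span {x, y}) {n : ℕ} (hn : n < multiplicity A) (c : ℕ → A)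
    (hc : ∑ i ∈ Finset.range (n + 1), c i * (x ^ (n - i) * y ^ i) ∈ maximalIdeal A ^ (n + 1)) :
    ∀ i ≤ n, c i ∈ maximalIdeal A := by
  suffices H : ∀ k ≤ n + 1, ∀ i, k ≤ i → i ≤ n → c i ∈ maximalIdeal A from
    fun i hi => H 0 (Nat.zero_le _) i (Nat.zero_le _) hi
  intro k hk
  induction hk using Nat.decreasingInduction with
  | self => intro i hi hi'; omega
  | of_succ j hj ih =>
    intro i hi hin
    obtain hlt | rfl := lt_or_eq_of_le hi
    · exact ih i hlt hin
    clear hi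
    by_contra hu
    obtain ⟨u, hu⟩ := not_not.1 ((mem_nonunits_iff).not.1 hu)
    refine absurd (multiplicity_le_of_mem h hm hin ?_) (by omega)
    have hc2 : ∑ i ∈ Finset.range (j + 1), c i * (x ^ (n - i) * y ^ i) ∈
        maximalIdeal A ^ (n + 1) := by
      rw [← Finset.sum_range_add_sum_Ico _ (Nat.succ_le_succ hin)] at hc
      refine (Ideal.add_mem_iff_left _ (Ideal.sum_mem _ fun i hi => ?_)).1 hc
      obtain ⟨h1, h2⟩ := Finset.mem_Ico.1 hi
      rw [pow_succ']
      exact Ideal.mul_mem_mul (ih i h1 (by omega)) (sum_pow_mul_pow_mem hm _ (by omega))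
    rw [Finset.sum_range_succ, ← hu] at hc2
    have e : x ^ (n - j) * y ^ j = ↑u⁻¹ * (-∑ i ∈ Finset.range j, c i * (x ^ (n - i) * y ^ i)) +
        ↑u⁻¹ * (∑ i ∈ Finset.range j, c i * (x ^ (n - i) * y ^ i) +
          ↑u * (x ^ (n - j) * y ^ j)) := by
      rw [mul_add _ _ (_ * _), ← mul_assoc (↑u⁻¹ : A) ↑u, Units.inv_mul]
      ring
    rw [e]
    refine Submodule.add_mem_sup (Ideal.mul_mem_left _ _ (neg_mem (Ideal.sum_mem _ fun i hi => ?_)))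
      (Ideal.mul_mem_left _ _ hc2)
    exact Ideal.mul_mem_left _ _ (Ideal.subset_span ⟨⟨i, Finset.mem_range.1 hi⟩, rfl⟩)

omit [IsLocalRing A] in
theorem shiftedSum_pow (e n : ℕ) (hn : n < e) (c : ℕ → A) :
    shiftedSum x (fun i : Fin e => (i : ℕ)) (fun i => y ^ (i : ℕ)) n (fun i => c i)
      = ∑ i ∈ Finset.range (n + 1), c i * (x ^ (n - i) * y ^ i) := by
  rw [shiftedSum, Fin.sum_univ_eq_sum_range
    (fun i => if i ≤ n then c i * (x ^ (n - i) * y ^ i) else 0), ← Finset.sum_filter]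
  congr 1
  ext i
  simp only [Finset.mem_filter, Finset.mem_range]
  omega

/-- In degrees up to e-1 the monomials in x and y span and are independent. This also makes e-1 a
valid exponent in 𝔪ⁿ⁺¹ = x𝔪ⁿ, so no higher degree needs to be examined. -/
theorem exists_isFreeBasis_of_embDim_eq_two [IsNoetherianRing A] (h : IsRegularReduction x r)
    (hb : embDim A = 2) :
    ∃ y : A, IsFreeBasis x (fun i : Fin (multiplicity A) => (i : ℕ)) (fun i => y ^ (i : ℕ)) := by
  obtain ⟨n, y, hn, hy, hspan, -⟩ := exists_basis_with h
  obtain rfl : n = 1 := by omega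
  have hm : maximalIdeal A = Ideal.span {x, y 0} := by
    refine le_antisymm ?_ ?_
    -- By Nakayama, generators of 𝔪 modulo 𝔪² generate 𝔪.
    · refine Submodule.le_of_le_smul_of_le_jacobson_bot (I := maximalIdeal A)
        (IsNoetherian.noetherian _) (maximalIdeal_le_jacobson _) fun a ha => ?_
      obtain ⟨b, c, hc⟩ := hspan a ha
      rw [smul_eq_mul, ← pow_two, ← sub_add_cancel a (b * x + ∑ s, c s * y s), add_comm]
      refine Submodule.add_mem_sup ?_ hc
      rw [Fin.sum_univ_one]
      exact Ideal.mem_span_pair.2 ⟨_, _, rfl⟩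
    · rw [Ideal.span_le]
      rintro _ (rfl | rfl)
      exacts [h.mem, hy 0]
  refine ⟨y 0, ?_⟩
  generalize y 0 = y at hm
  clear hspan hy hn
  have he := multiplicity_pos h
  have hmem : ∀ i : Fin (multiplicity A), y ^ (i : ℕ) ∈ maximalIdeal A ^ (i : ℕ) := fun i =>
    Ideal.pow_mem_pow (hm ▸ Ideal.subset_span (by simp)) _
  have hspan : ∀ n ≤ multiplicity A - 1, ∀ a ∈ maximalIdeal A ^ n, ∃ c, a - shiftedSum x
      (fun i : Fin (multiplicity A) => (i : ℕ)) (fun i => y ^ (i : ℕ)) n c ∈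
        maximalIdeal A ^ (n + 1) := by
    intro n hn a ha
    rw [hm] at ha
    obtain ⟨c, rfl⟩ := exists_sum_of_mem_span_pair_pow ha
    exact ⟨fun i => c i, by rw [shiftedSum_pow _ _ (by omega) c]; simp⟩
  have hind : ∀ n ≤ multiplicity A - 1, ∀ c, shiftedSum x
      (fun i : Fin (multiplicity A) => (i : ℕ)) (fun i => y ^ (i : ℕ)) n c ∈
        maximalIdeal A ^ (n + 1) → ∀ s : Fin (multiplicity A), (s : ℕ) ≤ n → c s ∈ maximalIdeal A := by
    intro n hn c hc s hs
    obtain ⟨c, rfl⟩ : ∃ c' : ℕ → A, c = fun i : Fin (multiplicity A) => c' i :=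
      ⟨fun k => if hk : k < multiplicity A then c ⟨k, hk⟩ else 0, funext fun i => by simp⟩
    rw [shiftedSum_pow _ _ (by omega)] at hc
    exact coeff_mem_of_sum_mem h hm (by omega) _ hc s hs
  have hle : ∀ s : Fin (multiplicity A), (s : ℕ) ≤ multiplicity A - 1 := fun s => by
    have := s.2; omega
  have hH : hilbertFunction (maximalIdeal A) (multiplicity A - 1) = multiplicity A := by
    have key : ∀ c : Fin (multiplicity A) → A, shiftedSum x
      (fun i : Fin (multiplicity A) => (i : ℕ)) (fun i => y ^ (i : ℕ)) (multiplicity A - 1) c =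
        ∑ i, c i • (x ^ (multiplicity A - 1 - i) * y ^ (i : ℕ)) := fun c =>
      Finset.sum_congr rfl fun s _ => if_pos (hle s)
    rw [hilbertFunction, lengthQuot_eq_card
      (fun i : Fin (multiplicity A) => x ^ (multiplicity A - 1 - i) * y ^ (i : ℕ)),
      Fintype.card_fin]
    · exact fun s => sum_pow_mul_pow_mem hm _ (hle s)
    · intro s a ha
      rw [pow_succ']
      exact Ideal.mul_mem_mul ha (sum_pow_mul_pow_mem hm _ (hle s))
    · intro z hz
      obtain ⟨c, hc⟩ := hspan _ le_rfl z hz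
      exact ⟨c, by rwa [← key]⟩
    · intro c hc s
      rw [← key] at hc
      exact hind _ le_rfl c hc s (hle s)
  -- λ(A/x𝔪ᵉ⁻¹) and λ(A/𝔪ᵉ) both equal λ(A/𝔪ᵉ⁻¹) + e, the latter by `hH`.
  have hred : IsRegularReduction x (multiplicity A - 1) := by
    refine ⟨h.mem, h.regular, ?_⟩
    have h1 := h.length_span_mul (maximalIdeal A ^ (multiplicity A - 1))
    have h2 := length_quotient_pow_succ (A := A) (multiplicity A - 1)
    rw [h.length_eq_multiplicity] at h1
    rw [hH] at h2
    refine (eq_of_length_quotient_eq ?_ (length_pow_quotient_ne_top _) ?_).symm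
    · rw [pow_succ']
      exact Ideal.mul_mono_left ((Ideal.span_singleton_le_iff_mem _).2 h.mem)
    · rw [h1, h2, add_comm]
  exact IsFreeBasis.of_le hred le_rfl hle hmem hspan hind

end EmbDimTwo

theorem sum_subtype_eq_sum_ite {ι M : Type*} [Fintype ι] [AddCommMonoid M] (p : ι → Prop)
    [DecidablePred p] (f : ι → M) : ∑ s : {s // p s}, f s = ∑ s, if p s then f s else 0 := by
  rw [← Finset.sum_filter]
  exact (Finset.sum_subtype _ (by simp) f).symm

theorem exists_extend_subtype {ι M : Type*} [Zero M] (p : ι → Prop)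
    (c : {s // p s} → M) : ∃ c' : ι → M, c = fun s : {s // p s} => c' s := by
  classical
  exact ⟨fun s => if h : p s then c ⟨s, h⟩ else 0, funext fun s => by simp [s.2]⟩

/-! ### Consequences of freeness: regularity of x*, Apery invariants, Hilbert function modulo x -/

section FreeBasis

variable {A : Type u} [CommRing A] {ι : Type*} [Fintype ι] {x : A} {d : ι → ℕ} {y : ι → A}

theorem shiftedSum_succ (n : ℕ) (c : ι → A) : shiftedSum x d y (n + 1) c =
    x * shiftedSum x d y n c + ∑ s, if d s = n + 1 then c s * y s else 0 := by
  rw [shiftedSum, shiftedSum, Finset.mul_sum, ← Finset.sum_add_distrib]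
  refine Finset.sum_congr rfl fun s _ => ?_
  obtain h | h | h : d s ≤ n ∨ d s = n + 1 ∨ n + 1 < d s := by omega
  · rw [if_pos h, if_pos (by omega), if_neg (by omega), show n + 1 - d s = (n - d s) + 1 by omega]
    ring
  · rw [if_pos h.le, if_neg (by omega), if_pos h, h]
    simp
  · rw [if_neg (by omega), if_neg (by omega), if_neg (by omega)]
    simp

/-- The terms with d s ≤ i carry the factor xʳ and, divided by it, lie in A; the others describe (A
+ 𝔪ⁱA')/(A + 𝔪ⁱ⁺¹A'). -/
theorem shiftedSum_add_eq_add {r : ℕ} (hd : ∀ s, d s ≤ r) (i : ℕ) (c : ι → A) :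
    shiftedSum x d y (r + i) c = x ^ r * shiftedSum x d y i c +
      ∑ s, if i < d s then c s * (x ^ (r + i - d s) * y s) else 0 := by
  rw [shiftedSum, shiftedSum, Finset.mul_sum, ← Finset.sum_add_distrib]
  refine Finset.sum_congr rfl fun s _ => ?_
  have := hd s
  rw [if_pos (by omega)]
  obtain h | h := le_or_gt (d s) i
  · rw [if_pos h, if_neg (by omega), show r + i - d s = (i - d s) + r by omega]
    ring
  · rw [if_neg (by omega), if_pos h]
    simp

theorem shiftedSum_congr {n : ℕ} {c c' : ι → A} (h : ∀ s, d s ≤ n → c s = c' s) :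
    shiftedSum x d y n c = shiftedSum x d y n c' := by
  refine Finset.sum_congr rfl fun s _ => ?_
  split_ifs with hs
  · rw [h s hs]
  · rfl

theorem shiftedSum_neg (n : ℕ) (c : ι → A) :
    shiftedSum x d y n (fun s => -c s) = -shiftedSum x d y n c := by
  rw [shiftedSum, shiftedSum, ← Finset.sum_neg_distrib]
  refine Finset.sum_congr rfl fun s _ => ?_
  split_ifs <;> simp

variable [IsLocalRing A]

namespace IsFreeBasis

variable (hb : IsFreeBasis x d y)

include hb

theorem pow_mul_mem (hx : x ∈ maximalIdeal A) {n : ℕ} {s : ι} (hs : d s ≤ n) :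
    x ^ (n - d s) * y s ∈ maximalIdeal A ^ n := by
  have := Ideal.mul_mem_mul (Ideal.pow_mem_pow hx (n - d s)) (hb.mem s)
  rwa [← pow_add, Nat.sub_add_cancel hs] at this

theorem shiftedSum_mem (hx : x ∈ maximalIdeal A) (n : ℕ) (c : ι → A) :
    shiftedSum x d y n c ∈ maximalIdeal A ^ n := by
  refine Ideal.sum_mem _ fun s _ => ?_
  split_ifs with hs
  · exact Ideal.mul_mem_left _ _ (hb.pow_mul_mem hx hs)
  · exact zero_mem _

/-- This is regularity of x* on G(𝔪). If a ∈ 𝔪ᵏ with k < n, then xa has in degree k + 1 the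
coefficients that a has in degree k; as xa ∈ 𝔪ᵏ⁺², they lie in 𝔪, so a ∈ 𝔪ᵏ⁺¹. -/
theorem mem_of_mul_mem (hx : x ∈ maximalIdeal A) {n : ℕ} {a : A}
    (ha : x * a ∈ maximalIdeal A ^ (n + 1)) : a ∈ maximalIdeal A ^ n := by
  suffices H : ∀ k ≤ n, a ∈ maximalIdeal A ^ k from H n le_rfl
  intro k
  induction k with
  | zero => simp
  | succ k ih =>
    intro hk
    obtain ⟨c, hc⟩ := hb.span k a (ih (by omega))
    have hxc : x * (a - shiftedSum x d y k c) ∈ maximalIdeal A ^ (k + 1 + 1) := by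
      rw [pow_succ']
      exact Ideal.mul_mem_mul hx hc
    -- Generators of degree k + 1 enter only now, so their coefficients must be set to zero.
    have h1 : shiftedSum x d y (k + 1) (fun s => if d s ≤ k then c s else 0) =
        x * shiftedSum x d y k c := by
      rw [shiftedSum_succ, shiftedSum_congr (c' := c) fun s hs => if_pos hs]
      simp only [add_eq_left]
      refine Finset.sum_eq_zero fun s _ => ?_
      split_ifs <;> first | omega | simp
    have h2 : x * shiftedSum x d y k c ∈ maximalIdeal A ^ (k + 1 + 1) := by
      have := Ideal.sub_mem _ (Ideal.pow_le_pow_right (by omega : k + 1 + 1 ≤ n + 1) ha) hxc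
      rwa [mul_sub, sub_sub_cancel] at this
    have h3 := hb.indep (k + 1) _ (h1 ▸ h2)
    have h4 : shiftedSum x d y k c ∈ maximalIdeal A ^ (k + 1) := by
      refine Ideal.sum_mem _ fun s _ => ?_
      split_ifs with hs
      · have := h3 s (by omega)
        rw [if_pos hs] at this
        rw [pow_succ']
        exact Ideal.mul_mem_mul this (hb.pow_mul_mem hx hs)
      · exact zero_mem _
    simpa using Ideal.add_mem _ hc h4

theorem mem_of_pow_mul_mem (hx : x ∈ maximalIdeal A) {n k : ℕ} {a : A}
    (ha : x ^ k * a ∈ maximalIdeal A ^ (n + k)) : a ∈ maximalIdeal A ^ n := by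
  induction k with
  | zero => simpa using ha
  | succ k ih =>
    rw [pow_succ', mul_assoc] at ha
    exact ih (hb.mem_of_mul_mem hx ha)

/-- A generator of degree n + 1 > r would be xb with b ∈ 𝔪ⁿ. Expanding b gives a relation in degree
n + 1 with coefficient 1 at s. -/
theorem degree_le {r : ℕ} (h : IsRegularReduction x r) (s : ι) : d s ≤ r := by
  classical
  by_contra hs
  obtain ⟨n, hn⟩ : ∃ n, d s = n + 1 := ⟨d s - 1, by omega⟩
  obtain ⟨b, hbm, hyb⟩ := h.exists_eq_pow_mul (k := 1) (n := n) (by omega) (hn ▸ hb.mem s)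
  obtain ⟨c, hc⟩ := hb.span n b hbm
  have h1 := Ideal.mul_mem_mul h.mem hc
  rw [← pow_succ', mul_sub, ← pow_one x, ← hyb, pow_one] at h1
  have h2 : shiftedSum x d y (n + 1)
      (fun t => if d t ≤ n then -c t else if t = s then 1 else 0) =
        y s - x * shiftedSum x d y n c := by
    rw [shiftedSum_succ, shiftedSum_congr (c' := fun t => -c t) fun t ht => if_pos ht,
      shiftedSum_neg, Finset.sum_eq_single s]
    · rw [if_pos hn, if_neg (by omega), if_pos rfl]
      ring
    · intro t _ hts
      split_ifs <;> first | omega | simp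
    · simp
  have := hb.indep (n + 1) _ (h2 ▸ h1) s hn.le
  rw [if_neg (by omega), if_pos rfl] at this
  exact (Ideal.ne_top_iff_one _).1 (maximalIdeal.isMaximal A).ne_top this

/-- Terms of the degree n expansion with d s < n are divisible by x. -/
theorem exists_sub_sum_mem (n : ℕ) {a : A}
    (ha : a ∈ maximalIdeal A ^ n ⊔ Ideal.span {x}) : ∃ c : ι → A,
      a - ∑ s : {s // d s = n}, c s * y s ∈ maximalIdeal A ^ (n + 1) ⊔ Ideal.span {x} := by
  obtain ⟨z, hz, w, hw, rfl⟩ := Submodule.mem_sup.1 ha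
  obtain ⟨c, hc⟩ := hb.span n z hz
  refine ⟨c, ?_⟩
  have h1 : shiftedSum x d y n c - ∑ s : {s // d s = n}, c s * y s ∈ Ideal.span {x} := by
    rw [sum_subtype_eq_sum_ite (fun s => d s = n) fun s => c s * y s, shiftedSum,
      ← Finset.sum_sub_distrib]
    refine Ideal.sum_mem _ fun s _ => ?_
    obtain h | h | h := lt_trichotomy (d s) n
    · rw [if_pos h.le, if_neg h.ne, sub_zero, show n - d s = (n - d s - 1) + 1 by omega, pow_succ]
      refine Ideal.mem_span_singleton'.2 ⟨c s * (x ^ (n - d s - 1) * y s), by ring⟩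
    · rw [if_pos h.le, if_pos h, h]
      simp
    · rw [if_neg (by omega), if_neg (by omega)]
      simp
  have e : z + w - ∑ s : {s // d s = n}, c s * y s = (z - shiftedSum x d y n c) +
      (w + (shiftedSum x d y n c - ∑ s : {s // d s = n}, c s * y s)) := by ring
  rw [e]
  exact Submodule.add_mem_sup hc (Ideal.add_mem _ hw h1)

/-- Write the sum as z + xa with z ∈ 𝔪ⁿ⁺¹. For n > 0, xa ∈ 𝔪ⁿ, so a ∈ 𝔪ⁿ⁻¹ by regularity of x*.
Moving the expansion of xa to the left leaves a relation in degree n with the original coefficients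
at d s = n. -/
theorem coeff_mem_of_sum_mem_sup (hx : x ∈ maximalIdeal A) (n : ℕ) (c : ι → A)
    (hc : ∑ s : {s // d s = n}, c s * y s ∈ maximalIdeal A ^ (n + 1) ⊔ Ideal.span {x})
    (s : ι) (hs : d s = n) : c s ∈ maximalIdeal A := by
  rw [sum_subtype_eq_sum_ite (fun s => d s = n) fun s => c s * y s] at hc
  obtain ⟨z, hz, w, hw, hzw⟩ := Submodule.mem_sup.1 hc
  obtain ⟨a, rfl⟩ := Ideal.mem_span_singleton.1 hw
  cases n with
  | zero =>
    refine hb.indep 0 c ?_ s hs.le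
    have h1 : shiftedSum x d y 0 c = ∑ s, if d s = 0 then c s * y s else 0 := by
      refine Finset.sum_congr rfl fun s _ => ?_
      simp
    rw [h1, ← hzw]
    exact Ideal.add_mem _ hz (by simpa using Ideal.mul_mem_right a _ hx)
  | succ n =>
    have h1 : x * a ∈ maximalIdeal A ^ (n + 1) := by
      rw [← add_sub_cancel_left z (x * a), hzw]
      refine Ideal.sub_mem _ (Ideal.sum_mem _ fun s _ => ?_)
        (Ideal.pow_le_pow_right (Nat.le_succ _) hz)
      split_ifs with hs
      · exact Ideal.mul_mem_left _ _ (hs ▸ hb.mem s)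
      · exact zero_mem _
    obtain ⟨c', hc'⟩ := hb.span n a (hb.mem_of_mul_mem hx h1)
    have h2 := Ideal.mul_mem_mul hx hc'
    rw [← pow_succ'] at h2
    have h3 : shiftedSum x d y (n + 1) (fun t => if d t ≤ n then -c' t else c t) =
        z + x * (a - shiftedSum x d y n c') := by
      rw [shiftedSum_succ, shiftedSum_congr (c' := fun t => -c' t) fun t ht => if_pos ht,
        shiftedSum_neg, mul_sub, ← add_sub_assoc, hzw, sub_eq_neg_add, mul_neg]
      congr 1
      refine Finset.sum_congr rfl fun t _ => ?_
      split_ifs <;> first | omega | rfl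
    have := hb.indep (n + 1) _ (h3 ▸ Ideal.add_mem _ hz h2) s hs.le
    rwa [if_neg (by omega)] at this

theorem aperyInvariant_eq (hx : x ∈ maximalIdeal A) (n : ℕ) :
    aperyInvariant x n = Fintype.card {s // d s = n} := by
  have hmem : ∀ s : {s // d s = n}, y s ∈ maximalIdeal A ^ n := fun s => by
    have := hb.mem s
    rwa [s.2] at this
  refine lengthQuot_eq_card (fun s : {s // d s = n} => y s)
    (fun s => Submodule.mem_sup_left (hmem s)) ?_ ?_ ?_
  · intro s a ha
    rw [pow_succ']
    exact Submodule.mem_sup_left (Ideal.mul_mem_mul ha (hmem s))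
  · intro a ha
    obtain ⟨c, hc⟩ := hb.exists_sub_sum_mem n ha
    exact ⟨fun s => c s, hc⟩
  · intro c hc s
    obtain ⟨c, rfl⟩ := exists_extend_subtype _ c
    exact hb.coeff_mem_of_sum_mem_sup hx n c hc s s.2

theorem hilbertFunction_map_eq (hx : x ∈ maximalIdeal A) (n : ℕ) :
    hilbertFunction ((maximalIdeal A).map (Ideal.Quotient.mk (Ideal.span {x}))) n =
      Fintype.card {s // d s = n} := by
  have hle : Ideal.span {x} ≤ maximalIdeal A := (Ideal.span_singleton_le_iff_mem _).2 hx
  have hne : Ideal.span {x} ≠ ⊤ := fun ht =>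
    (maximalIdeal.isMaximal A).ne_top (top_le_iff.1 (ht ▸ hle))
  have : Nontrivial (A ⧸ Ideal.span {x}) := Ideal.Quotient.nontrivial_iff.2 hne
  have hsurj := Ideal.Quotient.mk_surjective (I := Ideal.span {x})
  have : IsLocalRing (A ⧸ Ideal.span {x}) := IsLocalRing.of_surjective' _ hsurj
  have hmax : maximalIdeal (A ⧸ Ideal.span {x}) =
      (maximalIdeal A).map (Ideal.Quotient.mk (Ideal.span {x})) :=
    (IsLocalRing.map_maximalIdeal_of_surjective _ hsurj).symm
  -- This dictionary carries the basis that computes γₙ over to A/xA.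
  have hmem : ∀ (k : ℕ) (a : A), Ideal.Quotient.mk (Ideal.span {x}) a ∈
      (maximalIdeal A).map (Ideal.Quotient.mk (Ideal.span {x})) ^ k ↔
        a ∈ maximalIdeal A ^ k ⊔ Ideal.span {x} := by
    intro k a
    rw [← Ideal.map_pow, ← Ideal.mem_comap, Ideal.comap_map_of_surjective _ hsurj,
      ← RingHom.ker_eq_comap_bot, Ideal.mk_ker]
  have hsum : ∀ c : ι → A, ∑ s : {s // d s = n},
      Ideal.Quotient.mk (Ideal.span {x}) (c s) • Ideal.Quotient.mk (Ideal.span {x}) (y s) =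
        Ideal.Quotient.mk (Ideal.span {x}) (∑ s : {s // d s = n}, c s * y s) := fun c => by
    simp
  have hymem : ∀ s : {s // d s = n}, y s ∈ maximalIdeal A ^ n := fun s => by
    have := hb.mem s
    rwa [s.2] at this
  refine lengthQuot_eq_card
    (fun s : {s // d s = n} => Ideal.Quotient.mk (Ideal.span {x}) (y s))
    (fun s => (hmem _ _).2 (Submodule.mem_sup_left (hymem s))) ?_ ?_ ?_
  · intro s a ha
    rw [hmax] at ha
    rw [pow_succ']
    exact Ideal.mul_mem_mul ha ((hmem _ _).2 (Submodule.mem_sup_left (hymem s)))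
  · intro a ha
    obtain ⟨a, rfl⟩ := hsurj a
    obtain ⟨c, hc⟩ := hb.exists_sub_sum_mem n ((hmem _ _).1 ha)
    refine ⟨fun s => Ideal.Quotient.mk _ (c s), ?_⟩
    rw [hsum, ← map_sub]
    exact (hmem _ _).2 hc
  · intro c hc s
    obtain ⟨c, rfl⟩ := exists_extend_subtype _ c
    choose c' hc' using fun s => hsurj (c s)
    obtain rfl : (fun s => Ideal.Quotient.mk _ (c' s)) = c := funext hc'
    rw [hsum] at hc
    rw [hmax]
    exact Ideal.mem_map_of_mem _ (hb.coeff_mem_of_sum_mem_sup hx n c' ((hmem _ _).1 hc) s s.2)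

end IsFreeBasis

end FreeBasis

/-! ### The first neighborhood ring and the micro-invariants -/

section Neighborhood

variable {A : Type u} [CommRing A] [IsLocalRing A] {x : A} {r : ℕ}

omit [IsLocalRing A] in
theorem algebraMap_fractionRing_injective :
    Function.Injective (algebraMap A (FractionRing A)) :=
  IsLocalization.injective _ le_rfl

namespace IsRegularReduction

variable (h : IsRegularReduction x r)

include h

theorem smul_cancel {n : ℕ} {z w : FractionRing A} (hzw : x ^ n • z = x ^ n • w) : z = w := by
  have hu : IsUnit (algebraMap A (FractionRing A) (x ^ n)) :=
    IsLocalization.map_units _ (⟨x ^ n, pow_mem h.mem_nonZeroDivisors n⟩ : nonZeroDivisors A)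
  rw [Algebra.smul_def, Algebra.smul_def] at hzw
  exact hu.mul_left_cancel hzw

theorem exists_smul_eq (n : ℕ) (b : A) :
    ∃ z : FractionRing A, x ^ n • z = algebraMap A (FractionRing A) b := by
  refine ⟨IsLocalization.mk' (FractionRing A) b
    (⟨x ^ n, pow_mem h.mem_nonZeroDivisors n⟩ : nonZeroDivisors A), ?_⟩
  rw [Algebra.smul_def]
  exact IsLocalization.mk'_spec' (FractionRing A) b
    (⟨x ^ n, pow_mem h.mem_nonZeroDivisors n⟩ : nonZeroDivisors A)

theorem isSuperficial_pow (n : ℕ) : IsSuperficial n (x ^ n) :=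
  ⟨Ideal.pow_mem_pow h.mem n,
    Filter.eventually_atTop.2 ⟨r, fun _ hk => h.pow_eq_pow_mul n hk⟩⟩

/-- That is, A' = x⁻ⁿ𝔪ⁿ. For b/a with a superficial of degree s and k large, bxᵏ ∈ 𝔪ᵏ⁺ˢ = a𝔪ᵏ and 𝔪ᵏ
= xᵏ⁻ⁿ𝔪ⁿ; cancel xᵏ⁻ⁿ. -/
theorem mem_firstNeighborhood_iff {n : ℕ} (hn : r ≤ n) {z : FractionRing A} :
    z ∈ firstNeighborhood A ↔
      ∃ b ∈ maximalIdeal A ^ n, x ^ n • z = algebraMap A (FractionRing A) b := by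
  constructor
  · rintro ⟨s, a, b, ⟨-, ha⟩, hb, rfl⟩
    obtain ⟨N, hN⟩ := Filter.eventually_atTop.1 ha
    obtain ⟨j, hj⟩ := Nat.exists_eq_add_of_le (le_max_left n N)
    obtain ⟨k, hk⟩ : ∃ m, m = max n N := ⟨_, rfl⟩
    rw [← hk] at hj
    have h1 : b * x ^ k ∈ maximalIdeal A ^ (k + s) := by
      rw [add_comm, pow_add]
      exact Ideal.mul_mem_mul hb (Ideal.pow_mem_pow h.mem k)
    rw [hN k (hk ▸ le_max_right _ _)] at h1
    obtain ⟨c, hc, hac⟩ := Ideal.mem_span_singleton_mul.1 h1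
    rw [hj] at hc
    obtain ⟨c', hc', rfl⟩ := h.exists_eq_pow_mul hn hc
    refine ⟨c', hc', ?_⟩
    have h2 : (a : A) * c' = b * x ^ n := by
      refine h.cancel_pow (n := j) ?_
      rw [mul_left_comm, hac, hj, pow_add]
      ring
    rw [Algebra.smul_def, IsLocalization.mul_mk'_eq_mk'_of_mul, IsLocalization.mk'_eq_iff_eq_mul,
      ← map_mul, mul_comm c', h2, mul_comm]
  · rintro ⟨b, hb, hz⟩
    refine ⟨n, ⟨x ^ n, pow_mem h.mem_nonZeroDivisors n⟩, b, h.isSuperficial_pow n, hb, ?_⟩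
    rw [IsLocalization.eq_mk'_iff_mul_eq, ← hz, Algebra.smul_def, mul_comm]

/-- From 𝔪ⁿ⁺ⁱ = xⁱ𝔪ⁿ one gets 𝔪ⁱA' = xⁱA' = x⁻ⁿ𝔪ⁿ⁺ⁱ. -/
theorem mem_pow_smul_firstNeighborhood_iff {n : ℕ} (hn : r ≤ n) (i : ℕ) {z : FractionRing A} :
    z ∈ (maximalIdeal A ^ i) • Subalgebra.toSubmodule (firstNeighborhood A) ↔
      ∃ b ∈ maximalIdeal A ^ (n + i), x ^ n • z = algebraMap A (FractionRing A) b := by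
  constructor
  · intro hz
    induction hz using Submodule.smul_induction_on' with
    | smul a ha w hw =>
      obtain ⟨b, hb, hwb⟩ := (h.mem_firstNeighborhood_iff hn).1 hw
      refine ⟨a * b, ?_, ?_⟩
      · rw [add_comm, pow_add]
        exact Ideal.mul_mem_mul ha hb
      · rw [smul_comm, hwb, Algebra.smul_def, map_mul]
    | add w _ w' _ ih ih' =>
      obtain ⟨b, hb, hwb⟩ := ih
      obtain ⟨b', hb', hwb'⟩ := ih'
      exact ⟨b + b', Ideal.add_mem _ hb hb', by rw [smul_add, hwb, hwb', map_add]⟩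
  · rintro ⟨b, hb, hz⟩
    obtain ⟨b, hb', rfl⟩ := h.exists_eq_pow_mul hn hb
    obtain ⟨w, hw⟩ := h.exists_smul_eq n b
    have : z = x ^ i • w := by
      refine h.smul_cancel (n := n) ?_
      rw [hz, smul_comm, hw, Algebra.smul_def, map_mul]
    rw [this]
    exact Submodule.smul_mem_smul (Ideal.pow_mem_pow h.mem i)
      ((h.mem_firstNeighborhood_iff hn).2 ⟨b, hb', hw⟩)

theorem mem_ringAddPow_iff (i : ℕ) {z : FractionRing A} :
    z ∈ ringAddPow A i ↔ ∃ a, ∃ b ∈ maximalIdeal A ^ (r + i),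
      x ^ r • z = algebraMap A (FractionRing A) (x ^ r * a + b) := by
  rw [ringAddPow, Submodule.mem_sup]
  constructor
  · rintro ⟨u, hu, w, hw, rfl⟩
    obtain ⟨a, rfl⟩ := Submodule.mem_one.1 hu
    obtain ⟨b, hb, hwb⟩ := (h.mem_pow_smul_firstNeighborhood_iff le_rfl i).1 hw
    exact ⟨a, b, hb, by rw [smul_add, hwb, map_add, map_mul, Algebra.smul_def]⟩
  · rintro ⟨a, b, hb, hz⟩
    refine ⟨algebraMap A _ a, Submodule.mem_one.2 ⟨a, rfl⟩, z - algebraMap A _ a,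
      (h.mem_pow_smul_firstNeighborhood_iff le_rfl i).2 ⟨b, hb, ?_⟩, by abel⟩
    rw [smul_sub, hz, map_add, map_mul, Algebra.smul_def]
    ring

end IsRegularReduction

variable {ι : Type*} [Fintype ι] {d : ι → ℕ} {y : ι → A}

/-- The basis consists of the fractions xⁱ⁻ᵈ⁽ˢ⁾yₛ with i < d s. After multiplication by xʳ, the
claim concerns 𝔪ʳ⁺ⁱ modulo xʳA and 𝔪ʳ⁺ⁱ⁺¹. -/
theorem IsFreeBasis.lengthQuot_ringAddPow (hb : IsFreeBasis x d y) (h : IsRegularReduction x r)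
    (i : ℕ) : lengthQuot (ringAddPow A i) (ringAddPow A (i + 1)) =
      Fintype.card {s // i < d s} := by
  choose v hv using fun s => h.exists_smul_eq r (x ^ (r + i - d s) * y s)
  have hd := hb.degree_le h
  have hvm : ∀ s, x ^ (r + i - d s) * y s ∈ maximalIdeal A ^ (r + i) := fun s =>
    hb.pow_mul_mem h.mem (by have := hd s; omega)
  have hsum : ∀ c : ι → A, x ^ r • ∑ s : {s // i < d s}, c s • v s =
      algebraMap A _ (shiftedSum x d y (r + i) c - x ^ r * shiftedSum x d y i c) := by
    intro c
    rw [shiftedSum_add_eq_add hd, add_sub_cancel_left,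
      ← sum_subtype_eq_sum_ite (fun s => i < d s) fun s => c s * (x ^ (r + i - d s) * y s),
      Finset.smul_sum, map_sum]
    refine Finset.sum_congr rfl fun s _ => ?_
    rw [smul_comm, hv, Algebra.smul_def, ← map_mul]
  refine lengthQuot_eq_card (fun s : {s // i < d s} => v s)
    (fun s => (h.mem_ringAddPow_iff i).2 ⟨0, _, hvm s, by rw [hv, mul_zero, zero_add]⟩) ?_ ?_ ?_
  · intro s a ha
    refine (h.mem_ringAddPow_iff _).2 ⟨0, a * (x ^ (r + i - d s) * y s), ?_, ?_⟩
    · rw [← add_assoc, pow_succ']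
      exact Ideal.mul_mem_mul ha (hvm s)
    · rw [smul_comm, hv, Algebra.smul_def, ← map_mul, mul_zero, zero_add]
  · intro z hz
    obtain ⟨a, b, hbm, hz⟩ := (h.mem_ringAddPow_iff _).1 hz
    obtain ⟨c, hc⟩ := hb.span _ b hbm
    refine ⟨fun s => c s, (h.mem_ringAddPow_iff _).2 ⟨a + shiftedSum x d y i c, _, hc, ?_⟩⟩
    rw [smul_sub, hsum c, hz, ← map_sub]
    congr 1
    ring
  · intro c hc s
    obtain ⟨c, rfl⟩ := exists_extend_subtype _ c
    obtain ⟨a, b, hbm, hz⟩ := (h.mem_ringAddPow_iff _).1 hc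
    have h1 := algebraMap_fractionRing_injective ((hsum c).symm.trans hz)
    -- Regularity of x* bounds the order of a, so a can be expanded in degree i and absorbed into
    -- the coefficients with d s ≤ i.
    have h2 : a ∈ maximalIdeal A ^ i := by
      refine hb.mem_of_pow_mul_mem h.mem (k := r) ?_
      have e : x ^ r * a = shiftedSum x d y (r + i) c - x ^ r * shiftedSum x d y i c - b := by
        rw [h1]; ring
      rw [e, add_comm i r]
      refine Ideal.sub_mem _ (Ideal.sub_mem _ (hb.shiftedSum_mem h.mem _ _) ?_)
        (Ideal.pow_le_pow_right (by omega) hbm)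
      rw [add_comm]
      exact h.pow_mul_mem r (hb.shiftedSum_mem h.mem _ _)
    obtain ⟨c', hc'⟩ := hb.span i a h2
    have h3 : shiftedSum x d y (r + i) (fun t => if i < d t then c t else -c' t) =
        x ^ r * (a - shiftedSum x d y i c') + b := by
      have h4 : shiftedSum x d y (r + i) c - x ^ r * shiftedSum x d y i c =
          shiftedSum x d y (r + i) (fun t => if i < d t then c t else -c' t) +
            x ^ r * shiftedSum x d y i c' := by
        rw [shiftedSum_add_eq_add hd, add_sub_cancel_left, shiftedSum_add_eq_add hd,
          shiftedSum_congr (c' := fun t => -c' t) fun t ht => if_neg (by omega),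
          shiftedSum_neg, mul_neg, add_right_comm, neg_add_cancel, zero_add]
        refine Finset.sum_congr rfl fun t _ => ?_
        split_ifs <;> rfl
      linear_combination h1 - h4
    have h5 := hb.indep (r + i) _ (h3 ▸ Ideal.add_mem _ (by
      have := h.pow_mul_mem r hc'
      rwa [show i + 1 + r = r + i + 1 by ring] at this) hbm) s
        (by have := hd s; omega)
    rwa [if_pos s.2] at h5

theorem IsFreeBasis.microInvariant_eq (hb : IsFreeBasis x d y) (h : IsRegularReduction x r)
    {i : ℕ} (hi : 1 ≤ i) : microInvariant A i = Fintype.card {s // d s = i} := by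
  classical
  obtain ⟨i, rfl⟩ := Nat.exists_eq_add_of_le' hi
  rw [microInvariant, hb.lengthQuot_ringAddPow h, hb.lengthQuot_ringAddPow h]
  have : Fintype.card {s // i < d s} =
      Fintype.card {s // d s = i + 1} + Fintype.card {s // i + 1 < d s} := by
    rw [← Fintype.card_subtype_or_disjoint]
    · exact Fintype.card_congr (Equiv.subtypeEquivRight fun s => by omega)
    · intro p hp hq s hs
      have h1 := hp s hs
      have h2 := hq s hs
      omega
  rw [this]
  push_cast
  ring

end Neighborhood

/-! ### Calculus in the graded rings F(I) -/

section FiberCone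

variable {A : Type u} [CommRing A] [IsLocalRing A]

/-- The inclusion `Iⁿ / 𝔪 Iⁿ → A / 𝔪 Iⁿ`. -/
def FiberPiece.toQuotient (I : Ideal A) (n : ℕ) :
    FiberPiece I n →ₗ[A] A ⧸ maximalIdeal A * I ^ n :=
  Submodule.mapQ _ (maximalIdeal A * I ^ n) (I ^ n).subtype fun _ h => h

theorem FiberPiece.toQuotient_mk (I : Ideal A) (n : ℕ) (a : ↥(I ^ n)) :
    FiberPiece.toQuotient I n (FiberPiece.mk I n a) = Ideal.Quotient.mk _ (a : A) :=
  rfl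

/-- The image in `A / 𝔪 Iⁿ` of the degree `n` component of an element of `F(I)`. -/
def FiberCone.coeff (I : Ideal A) (n : ℕ) : FiberCone I →+ A ⧸ maximalIdeal A * I ^ n where
  toFun g := FiberPiece.toQuotient I n (g n)
  map_zero' := by rw [DirectSum.zero_apply, map_zero]
  map_add' g g' := by rw [DirectSum.add_apply, map_add]

/-- The class in degree `n` of an element of `Iⁿ`. -/
def FiberCone.form (I : Ideal A) (n : ℕ) (a : A) (ha : a ∈ I ^ n) : FiberCone I :=
  DirectSum.of (FiberPiece I) n (FiberPiece.mk I n ⟨a, ha⟩)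

namespace FiberCone

variable {I J : Ideal A}

theorem coeff_apply (n : ℕ) (g : FiberCone I) :
    coeff I n g = FiberPiece.toQuotient I n (g n) :=
  rfl

theorem coeff_form {n : ℕ} {a : A} (ha : a ∈ I ^ n) (k : ℕ) :
    coeff I k (form I n a ha) = if n = k then Ideal.Quotient.mk _ a else 0 := by
  rw [coeff_apply, form]
  split_ifs with h
  · subst h
    rw [DirectSum.of_eq_same, FiberPiece.toQuotient_mk]
  · rw [DirectSum.of_eq_of_ne _ _ _ (Ne.symm h), map_zero]

/-- Iⁿ/𝔪Iⁿ embeds in A/𝔪Iⁿ, so equalities in F(I) can be tested on elements of A. -/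
theorem ext_coeff {g g' : FiberCone I} (h : ∀ n, coeff I n g = coeff I n g') : g = g' := by
  refine DFinsupp.ext fun n => ?_
  have h1 := h n
  rw [coeff_apply, coeff_apply] at h1
  obtain ⟨a, ha⟩ := FiberPiece.mk_surjective I n (g n)
  obtain ⟨b, hb⟩ := FiberPiece.mk_surjective I n (g' n)
  rw [← ha, ← hb, FiberPiece.toQuotient_mk, FiberPiece.toQuotient_mk] at h1
  refine ha.symm.trans (Eq.trans ?_ hb)
  rw [FiberPiece.mk_eq_mk]
  exact Ideal.Quotient.eq.1 h1

theorem form_mul_form {i j : ℕ} {a b : A} (ha : a ∈ I ^ i) (hb : b ∈ I ^ j) :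
    form I i a ha * form I j b hb =
      form I (i + j) (a * b) (by rw [pow_add]; exact Ideal.mul_mem_mul ha hb) :=
  DirectSum.of_mul_of _ _

theorem form_congr {i j : ℕ} {a b : A} (ha : a ∈ I ^ i) (h : i = j) (hab : a = b) :
    form I i a ha = form I j b (h ▸ hab ▸ ha) := by
  subst h hab
  rfl

theorem form_eq_zero_iff {n : ℕ} {a : A} (ha : a ∈ I ^ n) :
    form I n a ha = 0 ↔ a ∈ maximalIdeal A * I ^ n := by
  constructor
  · intro h
    have := coeff_form ha n
    rw [h, map_zero, if_pos rfl] at this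
    exact Ideal.Quotient.eq_zero_iff_mem.1 this.symm
  · intro h
    refine ext_coeff fun k => ?_
    rw [coeff_form, map_zero]
    split_ifs with hk
    · subst hk
      exact Ideal.Quotient.eq_zero_iff_mem.2 h
    · rfl

theorem exists_form_of_mem_piece {n : ℕ} {g : FiberCone I} (hg : g ∈ piece I n) :
    ∃ a ha, g = form I n a ha := by
  obtain ⟨g, rfl⟩ := hg
  obtain ⟨a, rfl⟩ := FiberPiece.mk_surjective I n g
  exact ⟨a, a.2, rfl⟩

theorem form_mem_piece {n : ℕ} {a : A} (ha : a ∈ I ^ n) : form I n a ha ∈ piece I n :=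
  ⟨_, rfl⟩

theorem induction_form {p : FiberCone I → Prop} (h0 : p 0)
    (hform : ∀ n a ha, p (form I n a ha)) (hadd : ∀ g g', p g → p g' → p (g + g'))
    (g : FiberCone I) : p g := by
  induction g using DirectSum.induction_on with
  | zero => exact h0
  | of n g =>
    obtain ⟨a, rfl⟩ := FiberPiece.mk_surjective I n g
    exact hform n a a.2
  | add g g' hg hg' => exact hadd g g' hg hg'

theorem map_form (h : I ≤ J) {n : ℕ} {a : A} (ha : a ∈ I ^ n) :
    map h (form I n a ha) = form J n a (Ideal.pow_right_mono h n ha) := by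
  rw [map, form]
  exact DirectSum.toSemiring_of _ _ _ _ _

theorem ofDegreeOne_pow {x : A} (hx : x ∈ I) (n : ℕ) :
    ofDegreeOne I x hx ^ n = form I n (x ^ n) (Ideal.pow_mem_pow hx n) := by
  induction n with
  | zero => rw [pow_zero]; exact form_congr (i := 0) (a := 1) (by simp) rfl (pow_zero x).symm
  | succ n ih =>
    rw [_root_.pow_succ, ih]
    exact (form_mul_form (Ideal.pow_mem_pow hx n) (by rwa [pow_one])).trans
      (form_congr _ rfl (_root_.pow_succ x n).symm)

/-- The homomorphism `K[X] → F(I)` that sends `X` to the class of `x` in degree `1`. -/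
def ofPolynomial (I : Ideal A) (x : A) (hx : x ∈ I) : (ResidueField A)[X] →+* FiberCone I :=
  Polynomial.eval₂RingHom (ofResidueField I) (ofDegreeOne I x hx)

theorem ofPolynomial_monomial {x : A} (hx : x ∈ I) (n : ℕ) (c : A) :
    ofPolynomial I x hx (Polynomial.monomial n (residue A c)) =
      form I n (c * x ^ n) (Ideal.mul_mem_left _ _ (Ideal.pow_mem_pow hx n)) := by
  rw [ofPolynomial, Polynomial.coe_eval₂RingHom, Polynomial.eval₂_monomial, ofDegreeOne_pow]
  exact (form_mul_form (i := 0) (a := c) (by simp) (Ideal.pow_mem_pow hx n)).trans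
    (form_congr _ (zero_add n) rfl)

theorem ofPolynomial_X {x : A} (hx : x ∈ I) :
    ofPolynomial I x hx Polynomial.X = ofDegreeOne I x hx := by
  rw [ofPolynomial, Polynomial.coe_eval₂RingHom, Polynomial.eval₂_X]

theorem map_ofPolynomial (h : I ≤ J) {x : A} (hx : x ∈ I) (p : (ResidueField A)[X]) :
    map h (ofPolynomial I x hx p) = ofPolynomial J x (h hx) p := by
  induction p using Polynomial.induction_on' with
  | add p q hp hq => simp only [map_add, hp, hq]
  | monomial n c =>
    obtain ⟨c, rfl⟩ := residue_surjective c
    rw [ofPolynomial_monomial, ofPolynomial_monomial, map_form]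

/-- A representative in `A` of an element of the residue field. -/
def liftResidue (a : ResidueField A) : A :=
  (residue_surjective a).choose

theorem residue_liftResidue (a : ResidueField A) : residue A (liftResidue a) = a :=
  (residue_surjective a).choose_spec

theorem coeff_ofPolynomial_mul_form {x : A} (hx : x ∈ I) (p : (ResidueField A)[X]) {d : ℕ} {b : A}
    (hb : b ∈ I ^ d) (n : ℕ) : coeff I n (ofPolynomial I x hx p * form I d b hb) =
      Ideal.Quotient.mk _
        (if d ≤ n then liftResidue (p.coeff (n - d)) * (x ^ (n - d) * b) else 0) := by
  have hmul : ∀ k c, ofPolynomial I x hx (Polynomial.monomial k (residue A c)) * form I d b hb =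
      form I (k + d) (c * (x ^ k * b)) (by
        rw [pow_add]
        exact Ideal.mul_mem_left _ _ (Ideal.mul_mem_mul (Ideal.pow_mem_pow hx k) hb)) := by
    intro k c
    rw [ofPolynomial_monomial, form_mul_form]
    exact form_congr _ rfl (mul_assoc _ _ _)
  -- The chosen lift of 0 need not be 0, but it lies in 𝔪.
  have hzero : ∀ k, p.coeff k = 0 → ∀ h : k + d = n, (Ideal.Quotient.mk (maximalIdeal A * I ^ n))
      (liftResidue (p.coeff k) * (x ^ k * b)) = 0 := by
    intro k hk h
    rw [Ideal.Quotient.eq_zero_iff_mem]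
    refine Ideal.mul_mem_mul ?_ ?_
    · rw [← residue_eq_zero_iff, residue_liftResidue, hk]
    · rw [← h, pow_add]
      exact Ideal.mul_mem_mul (Ideal.pow_mem_pow hx k) hb
  conv_lhs => rw [← p.sum_monomial_eq, Polynomial.sum_def]
  rw [map_sum, Finset.sum_mul, map_sum]
  have hterm : ∀ k, coeff I n (ofPolynomial I x hx (Polynomial.monomial k (p.coeff k)) *
      form I d b hb) = if k + d = n then
        Ideal.Quotient.mk _ (liftResidue (p.coeff k) * (x ^ k * b)) else 0 := by
    intro k
    conv_lhs => rw [← residue_liftResidue (p.coeff k), hmul, coeff_form]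
  simp only [hterm]
  split_ifs with hd
  · rw [Finset.sum_eq_single (n - d)]
    · rw [if_pos (by omega)]
    · intro k _ hk
      rw [if_neg (by omega)]
    · intro hk
      rw [if_pos (by omega)]
      exact hzero _ (by simpa using hk) (by omega)
  · rw [map_zero]
    exact Finset.sum_eq_zero fun k _ => if_neg (by omega)

end FiberCone

end FiberCone

/-! ### Free bases of A versus graded bases of G(𝔪) over K[X] -/

section FreeMap

variable {A : Type u} [CommRing A] [IsLocalRing A] {ι : Type*} [Fintype ι] {x : A}
  (hx : x ∈ maximalIdeal A) {d : ι → ℕ} {y : ι → A}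

open FiberCone

/-- The tuple of homogeneous polynomials `cₛ Xⁿ⁻ᵈ⁽ˢ⁾`. -/
def homogeneousTuple (d : ι → ℕ) (n : ℕ) (c : ι → A) : ι → (ResidueField A)[X] := fun s =>
  if d s ≤ n then Polynomial.monomial (n - d s) (residue A (c s)) else 0

omit [Fintype ι] in
theorem mem_sumPiece_iff_exists {n : ℕ} {f : ι → (ResidueField A)[X]} :
    f ∈ sumPiece (fun _ : ι => polynomialPiece (ResidueField A)) d n ↔
      ∃ c : ι → A, f = homogeneousTuple d n c := by
  constructor
  · intro hf
    have h1 : ∀ s, ∃ c : A,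
        f s = if d s ≤ n then Polynomial.monomial (n - d s) (residue A c) else 0 := by
      intro s
      have h2 : f s ∈ shiftPiece (polynomialPiece (ResidueField A)) (d s) n := hf s trivial
      rw [shiftPiece] at h2
      split_ifs with hs
      · rw [if_pos hs] at h2
        obtain ⟨c, hc⟩ := h2
        obtain ⟨c, rfl⟩ := residue_surjective c
        exact ⟨c, hc.symm⟩
      · rw [if_neg hs] at h2
        exact ⟨0, h2⟩
    choose c hc using h1
    exact ⟨c, funext hc⟩
  · rintro ⟨c, rfl⟩ s -
    change homogeneousTuple d n c s ∈ shiftPiece (polynomialPiece (ResidueField A)) (d s) n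
    rw [shiftPiece, homogeneousTuple]
    split_ifs
    · exact ⟨_, rfl⟩
    · exact zero_mem _

/-- The map `⨁ₛ K[X] → G(𝔪)` that sends the basis vector with index `s` to the class of `yₛ` in
degree `d s`. -/
def freeMap (d : ι → ℕ) (y : ι → A) (hy : ∀ s, y s ∈ maximalIdeal A ^ d s) :
    (ι → (ResidueField A)[X]) →+ FiberCone (maximalIdeal A) where
  toFun f := ∑ s, ofPolynomial _ x hx (f s) * form _ (d s) (y s) (hy s)
  map_zero' := by simp
  map_add' f g := by simp [add_mul, Finset.sum_add_distrib]

variable (hy : ∀ s, y s ∈ maximalIdeal A ^ d s)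

theorem freeMap_apply (f : ι → (ResidueField A)[X]) :
    freeMap hx d y hy f = ∑ s, ofPolynomial _ x hx (f s) * form _ (d s) (y s) (hy s) :=
  rfl

theorem freeMap_smul (p : (ResidueField A)[X]) (f : ι → (ResidueField A)[X]) :
    freeMap hx d y hy (p • f) = ofPolynomial _ x hx p * freeMap hx d y hy f := by
  rw [freeMap_apply, freeMap_apply, Finset.mul_sum]
  refine Finset.sum_congr rfl fun s _ => ?_
  rw [Pi.smul_apply, smul_eq_mul, map_mul, mul_assoc]

/-- This translates the conditions of `IsFreeBasis`, stated in A, into bijectivity of `freeMap`. -/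
theorem coeff_freeMap (f : ι → (ResidueField A)[X]) (n : ℕ) :
    FiberCone.coeff _ n (freeMap hx d y hy f) = Ideal.Quotient.mk _
      (shiftedSum x d y n fun s => liftResidue ((f s).coeff (n - d s))) := by
  rw [freeMap_apply, map_sum, shiftedSum, map_sum]
  exact Finset.sum_congr rfl fun s _ => coeff_ofPolynomial_mul_form _ _ _ _

include hx hy in
theorem shiftedSum_sub_mem {n : ℕ} {c c' : ι → A}
    (h : ∀ s, d s ≤ n → c s - c' s ∈ maximalIdeal A) :
    shiftedSum x d y n c - shiftedSum x d y n c' ∈ maximalIdeal A * maximalIdeal A ^ n := by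
  rw [shiftedSum, shiftedSum, ← Finset.sum_sub_distrib]
  refine Ideal.sum_mem _ fun s _ => ?_
  split_ifs with hs
  · rw [← sub_mul]
    refine Ideal.mul_mem_mul (h s hs) ?_
    have := Ideal.mul_mem_mul (Ideal.pow_mem_pow hx (n - d s)) (hy s)
    rwa [← pow_add, Nat.sub_add_cancel hs] at this
  · simp

include hx hy in
theorem shiftedSum_mem_pow (n : ℕ) (c : ι → A) :
    shiftedSum x d y n c ∈ maximalIdeal A ^ n := by
  refine Ideal.sum_mem _ fun s _ => ?_
  split_ifs with hs
  · have := Ideal.mul_mem_mul (Ideal.pow_mem_pow hx (n - d s)) (hy s)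
    rw [← pow_add, Nat.sub_add_cancel hs] at this
    exact Ideal.mul_mem_left _ _ this
  · exact zero_mem _

theorem freeMap_homogeneousTuple (n : ℕ) (c : ι → A) :
    freeMap hx d y hy (homogeneousTuple d n c) =
      form _ n (shiftedSum x d y n c) (shiftedSum_mem_pow hx hy n c) := by
  have hlift : ∀ a : A, liftResidue (residue A a) - a ∈ maximalIdeal A := fun a => by
    rw [← residue_eq_zero_iff, map_sub, residue_liftResidue, sub_self]
  refine ext_coeff fun k => ?_
  rw [coeff_freeMap, coeff_form]
  split_ifs with hk
  · subst hk
    refine Ideal.Quotient.eq.2 (shiftedSum_sub_mem hx hy fun s hs => ?_)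
    rw [homogeneousTuple, if_pos hs, Polynomial.coeff_monomial_same]
    exact hlift _
  · rw [Ideal.Quotient.eq_zero_iff_mem]
    have := shiftedSum_sub_mem hx hy (n := k) (c' := 0)
      (c := fun s => liftResidue ((homogeneousTuple d n c s).coeff (k - d s))) fun s hs => by
        have h0 : (homogeneousTuple d n c s).coeff (k - d s) = 0 := by
          rw [homogeneousTuple]
          split_ifs with hn
          · exact Polynomial.coeff_monomial_of_ne _ (by omega)
          · simp
        rw [h0, ← map_zero (residue A)]
        exact hlift 0
    simpa [shiftedSum] using this

theorem IsFreeBasis.freeMap_injective (hb : IsFreeBasis x d y) :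
    Function.Injective (freeMap hx d y hb.mem) := by
  rw [injective_iff_map_eq_zero]
  intro f hf
  funext s
  ext k
  -- Degree k + d s is where the coefficient of Xᵏ in f s appears.
  have h1 := coeff_freeMap hx hb.mem f (k + d s)
  rw [hf, map_zero, eq_comm, Ideal.Quotient.eq_zero_iff_mem, ← pow_succ'] at h1
  have h2 := hb.indep _ _ h1 s (Nat.le_add_left _ _)
  rw [← residue_eq_zero_iff, residue_liftResidue, Nat.add_sub_cancel] at h2
  simpa using h2

theorem IsFreeBasis.exists_freeMap_eq (hb : IsFreeBasis x d y) (n : ℕ)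
    {g : FiberCone (maximalIdeal A)} (hg : g ∈ piece _ n) :
    ∃ c, freeMap hx d y hb.mem (homogeneousTuple d n c) = g := by
  obtain ⟨a, ha, rfl⟩ := exists_form_of_mem_piece hg
  obtain ⟨c, hc⟩ := hb.span n a ha
  refine ⟨c, ?_⟩
  rw [freeMap_homogeneousTuple]
  refine ext_coeff fun k => ?_
  rw [coeff_form, coeff_form]
  split_ifs with hk
  · subst hk
    rw [Ideal.Quotient.eq, ← neg_sub, ← pow_succ']
    exact neg_mem hc
  · rfl

theorem IsFreeBasis.freeMap_bijective (hb : IsFreeBasis x d y) :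
    Function.Bijective (freeMap hx d y hb.mem) := by
  refine ⟨hb.freeMap_injective hx, fun g => ?_⟩
  induction g using induction_form with
  | h0 => exact ⟨0, map_zero _⟩
  | hform n a ha =>
    obtain ⟨c, hc⟩ := hb.exists_freeMap_eq hx n (form_mem_piece ha)
    exact ⟨_, hc⟩
  | hadd g g' hg hg' =>
    obtain ⟨f, rfl⟩ := hg
    obtain ⟨f', rfl⟩ := hg'
    exact ⟨f + f', map_add _ _ _⟩

theorem IsFreeBasis.freeMap_mem_piece_iff (hb : IsFreeBasis x d y) {n : ℕ}
    {f : ι → (ResidueField A)[X]} : freeMap hx d y hb.mem f ∈ piece _ n ↔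
      f ∈ sumPiece (fun _ : ι => polynomialPiece (ResidueField A)) d n := by
  rw [mem_sumPiece_iff_exists]
  constructor
  · intro hf
    obtain ⟨c, hc⟩ := hb.exists_freeMap_eq hx n hf
    exact ⟨c, (hb.freeMap_injective hx hc).symm⟩
  · rintro ⟨c, rfl⟩
    rw [freeMap_homogeneousTuple]
    exact form_mem_piece _

/-- The converse passage: an abstract graded decomposition of G(𝔪) yields a free basis in A, to
which the counting results apply. -/
theorem isFreeBasis_of_freeMap (hinj : Function.Injective (freeMap hx d y hy))
    (hsurj : ∀ n, ∀ g ∈ piece (maximalIdeal A) n,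
      ∃ f ∈ sumPiece (fun _ : ι => polynomialPiece (ResidueField A)) d n,
        freeMap hx d y hy f = g) : IsFreeBasis x d y := by
  refine ⟨hy, fun n a ha => ?_, fun n c hc s hs => ?_⟩
  · obtain ⟨f, hf, hfa⟩ := hsurj n _ (form_mem_piece ha)
    obtain ⟨c, rfl⟩ := mem_sumPiece_iff_exists.1 hf
    refine ⟨c, ?_⟩
    rw [freeMap_homogeneousTuple] at hfa
    have := congrArg (FiberCone.coeff _ n) hfa.symm
    rw [coeff_form, coeff_form, if_pos rfl, if_pos rfl, Ideal.Quotient.eq, ← pow_succ'] at this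
    exact this
  · have h1 : freeMap hx d y hy (homogeneousTuple d n c) = 0 := by
      rw [freeMap_homogeneousTuple, form_eq_zero_iff, ← pow_succ']
      exact hc
    have h2 := congrFun ((injective_iff_map_eq_zero _).1 hinj _ h1) s
    rw [homogeneousTuple, if_pos hs, Pi.zero_apply, Polynomial.monomial_eq_zero_iff,
      residue_eq_zero_iff] at h2
    exact h2

theorem IsFreeBasis.tangentConeIsoFree {ι : Type} [Fintype ι] {d : ι → ℕ} {y : ι → A}
    (hb : IsFreeBasis x d y) : TangentConeIsoFree x hx d := by
  let e := AddEquiv.ofBijective (freeMap hx d y hb.mem) (hb.freeMap_bijective hx)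
  refine ⟨e.symm, fun p g => ?_, fun n g => ?_⟩
  · obtain ⟨f, rfl⟩ := e.surjective g
    rw [e.symm_apply_apply, AddEquiv.symm_apply_eq]
    exact (freeMap_smul hx hb.mem p f).symm
  · obtain ⟨f, rfl⟩ := e.surjective g
    rw [e.symm_apply_apply]
    exact hb.freeMap_mem_piece_iff hx

theorem IsFreeBasis.comp_equiv (hb : IsFreeBasis x d y) {ι' : Type*} [Fintype ι'] (e : ι' ≃ ι) :
    IsFreeBasis x (d ∘ e) (y ∘ e) := by
  have key : ∀ n c, shiftedSum x (d ∘ e) (y ∘ e) n c = shiftedSum x d y n (c ∘ e.symm) := by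
    intro n c
    refine Fintype.sum_equiv e _ _ fun s => ?_
    simp
  refine ⟨fun s => hb.mem _, fun n a ha => ?_, fun n c hc s hs => ?_⟩
  · obtain ⟨c, hc⟩ := hb.span n a ha
    refine ⟨c ∘ e, ?_⟩
    rw [key]
    convert hc
    ext s
    simp
  · rw [key] at hc
    simpa using hb.indep n _ hc (e s) hs

end FreeMap

/-! ### Decompositions of the tangent cone over F(x) -/

section Decomposition

variable {A : Type u} [CommRing A] [IsLocalRing A] {x : A} {r : ℕ}

open FiberCone

omit [IsLocalRing A] in
theorem exists_eq_mul_pow_of_mem {n : ℕ} {a : A} (ha : a ∈ Ideal.span {x} ^ n) :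
    ∃ c, a = c * x ^ n := by
  rw [Ideal.span_singleton_pow] at ha
  obtain ⟨c, hc⟩ := Ideal.mem_span_singleton'.1 ha
  exact ⟨c, hc.symm⟩

theorem exists_ofPolynomial_monomial_eq {n : ℕ} {f : FiberCone (Ideal.span {x})}
    (hf : f ∈ piece _ n) : ∃ c, ofPolynomial _ x (Ideal.mem_span_singleton_self x)
      (Polynomial.monomial n c) = f := by
  obtain ⟨a, ha, rfl⟩ := exists_form_of_mem_piece hf
  obtain ⟨c, rfl⟩ := exists_eq_mul_pow_of_mem ha
  exact ⟨residue A c, ofPolynomial_monomial _ n c⟩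

namespace IsRegularReduction

variable (h : IsRegularReduction x r)

include h

/-- As x is regular, cxⁿ ∈ 𝔪xⁿ only for c ∈ 𝔪, so each xⁿA/xⁿ𝔪 is a copy of K. -/
theorem ofPolynomial_bijective : Function.Bijective
    (ofPolynomial (Ideal.span {x}) x (Ideal.mem_span_singleton_self x)) := by
  constructor
  · rw [injective_iff_map_eq_zero]
    intro p hp
    ext n
    have h1 := coeff_ofPolynomial_mul_form (Ideal.mem_span_singleton_self x) p (d := 0) (b := 1)
      (by simp) n
    rw [hp, zero_mul, map_zero, eq_comm, Ideal.Quotient.eq_zero_iff_mem, if_pos (Nat.zero_le n),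
      mul_one, Nat.sub_zero, Ideal.span_singleton_pow, mul_comm] at h1
    obtain ⟨b, hb, hb'⟩ := Ideal.mem_span_singleton_mul.1 h1
    rw [h.cancel_pow (hb'.trans (mul_comm _ _)), ← residue_eq_zero_iff, residue_liftResidue] at hb
    simpa using hb
  · intro f
    induction f using induction_form with
    | h0 => exact ⟨0, map_zero _⟩
    | hform n a ha =>
      obtain ⟨c, hc⟩ := exists_ofPolynomial_monomial_eq (form_mem_piece ha)
      exact ⟨_, hc⟩
    | hadd f f' hf hf' =>
      obtain ⟨p, rfl⟩ := hf
      obtain ⟨q, rfl⟩ := hf'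
      exact ⟨p + q, map_add _ _ _⟩

/-- The isomorphism `K[X] ≅ F(x)`. -/
def polynomialEquiv : (ResidueField A)[X] ≃+* FiberCone (Ideal.span {x}) :=
  RingEquiv.ofBijective _ h.ofPolynomial_bijective

theorem polynomialEquiv_apply (p : (ResidueField A)[X]) :
    h.polynomialEquiv p = ofPolynomial _ x (Ideal.mem_span_singleton_self x) p :=
  rfl

theorem polynomialEquiv_mem_piece_iff {n : ℕ} {p : (ResidueField A)[X]} :
    h.polynomialEquiv p ∈ piece (Ideal.span {x}) n ↔ p ∈ polynomialPiece (ResidueField A) n := by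
  constructor
  · intro hp
    obtain ⟨c, hc⟩ := exists_ofPolynomial_monomial_eq hp
    exact ⟨c, h.ofPolynomial_bijective.1 hc⟩
  · rintro ⟨c, rfl⟩
    obtain ⟨c, rfl⟩ := residue_surjective c
    exact (ofPolynomial_monomial _ n c).symm ▸ form_mem_piece _

theorem polynomialEquiv_mem_sumPiece_iff {ι : Type*} {d : ι → ℕ} {n : ℕ}
    {f : ι → (ResidueField A)[X]} :
    (fun s => h.polynomialEquiv (f s)) ∈ sumPiece (fun _ : ι => piece (Ideal.span {x})) d n ↔
      f ∈ sumPiece (fun _ : ι => polynomialPiece (ResidueField A)) d n := by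
  refine forall₂_congr fun s _ => ?_
  change h.polynomialEquiv (f s) ∈ shiftPiece _ (d s) n ↔ f s ∈ shiftPiece _ (d s) n
  rw [shiftPiece, shiftPiece]
  split_ifs
  · exact h.polynomialEquiv_mem_piece_iff
  · simp

theorem map_polynomialEquiv (p : (ResidueField A)[X]) :
    FiberCone.map ((Ideal.span_singleton_le_iff_mem _).2 h.mem) (h.polynomialEquiv p) =
      ofPolynomial _ x h.mem p :=
  map_ofPolynomial _ _ p

/-- In K[X] this is Xʲ ∤ Xʲ⁻¹. It provides a nonzero element of F(x)/(x*)ʲ that x* kills. -/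
theorem pow_notMem_span_pow {j : ℕ} (hj : 1 ≤ j) :
    ofDegreeOne (Ideal.span {x}) x (Ideal.mem_span_singleton_self x) ^ (j - 1) ∉
      Ideal.span {ofDegreeOne (Ideal.span {x}) x (Ideal.mem_span_singleton_self x) ^ j} := by
  rw [Ideal.mem_span_singleton, ← ofPolynomial_X, ← h.polynomialEquiv_apply, ← map_pow, ← map_pow,
    map_dvd_iff, pow_dvd_pow_iff Polynomial.X_ne_zero Polynomial.not_isUnit_X]
  omega

end IsRegularReduction

variable {ι : Type*} [Fintype ι] {d : ι → ℕ} {y : ι → A}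

theorem IsFreeBasis.isTangentConeInvariants (hb : IsFreeBasis x d y)
    (h : IsRegularReduction x (reductionNumber x)) :
    IsTangentConeInvariants x h.mem (fun i => Fintype.card {s // d s = i}) (fun _ _ => 0) := by
  classical
  refine ⟨fun i hi => ?_, ?_⟩
  · rw [Fintype.card_eq_zero_iff]
    exact ⟨fun s => by have := hb.degree_le h s; have := s.2; omega⟩
  let b : ι → Fin (reductionNumber x + 1) := fun s =>
    ⟨d s, Nat.lt_succ_of_le (hb.degree_le h s)⟩
  -- The index set is regrouped by degree; `degree_le` keeps the degrees within 0, …, r.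
  let e : (Σ i : Fin (reductionNumber x + 1), Fin (Fintype.card {s // d s = i})) ≃ ι :=
    (Equiv.sigmaCongrRight fun i : Fin (reductionNumber x + 1) =>
      (Fintype.equivFin {s // d s = i}).symm.trans
        (Equiv.subtypeEquivRight (q := fun s => b s = i) fun s => by simp [b, Fin.ext_iff])).trans
      (Equiv.sigmaFiberEquiv b)
  have he : d ∘ e = fun s => (s.1 : ℕ) := funext fun s =>
    ((Fintype.equivFin {t // d t = s.1}).symm s.2).2
  have hb' := hb.comp_equiv e
  rw [he] at hb'
  let φ := AddEquiv.ofBijective (freeMap h.mem _ _ hb'.mem) (hb'.freeMap_bijective h.mem)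
  let κ := Σ p : TorsionIndex (reductionNumber x), Fin ((fun _ _ : ℕ => 0) p.1.1 p.1.2)
  have hκ : IsEmpty κ := ⟨fun s => Nat.not_lt_zero _ s.2.2⟩
  let θ : (Σ i : Fin (reductionNumber x + 1), Fin (Fintype.card {s // d s = i})) →
      ((ResidueField A)[X] ≃+ FiberCone (Ideal.span {x})) := fun _ => h.polynomialEquiv.toAddEquiv
  refine ⟨(φ.symm.trans (AddEquiv.piCongrRight θ)).trans AddEquiv.prodUnique.symm,
    fun f g => ?_, fun n g => ?_⟩
  · obtain ⟨p, rfl⟩ := h.polynomialEquiv.surjective f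
    obtain ⟨f, rfl⟩ := φ.surjective g
    have h1 : φ.symm (FiberCone.map ((Ideal.span_singleton_le_iff_mem _).2 h.mem)
        (h.polynomialEquiv p) * φ f) = p • f := by
      rw [AddEquiv.symm_apply_eq, h.map_polynomialEquiv]
      exact (freeMap_smul h.mem hb'.mem p f).symm
    refine Prod.ext ?_ (Subsingleton.elim _ _)
    funext s
    change h.polynomialEquiv (φ.symm _ s) = h.polynomialEquiv p * h.polynomialEquiv (φ.symm (φ f) s)
    rw [h1, φ.symm_apply_apply, ← map_mul]
    rfl
  · obtain ⟨f, rfl⟩ := φ.surjective g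
    have h1 : ((φ.symm.trans (AddEquiv.piCongrRight θ)).trans
        (AddEquiv.prodUnique (N := ∀ s : κ, FiberCone (Ideal.span {x}) ⧸ Ideal.span
          {ofDegreeOne (Ideal.span {x}) x (Ideal.mem_span_singleton_self x) ^ s.1.1.2})).symm
        (φ f)).1 = fun s => h.polynomialEquiv (f s) := by
      funext s
      change h.polynomialEquiv (φ.symm (φ f) s) = _
      rw [φ.symm_apply_apply]
    refine (hb'.freeMap_mem_piece_iff h.mem).trans ?_
    rw [← h.polynomialEquiv_mem_sumPiece_iff, ← h1]
    exact (and_iff_left fun s => isEmptyElim s).symm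

theorem IsFreeBasis.eq_zero_of_mul_eq_zero (hb : IsFreeBasis x d y) (hx : x ∈ maximalIdeal A)
    {g : FiberCone (maximalIdeal A)} (hg : ofDegreeOne _ x hx * g = 0) : g = 0 := by
  obtain ⟨f, rfl⟩ := (hb.freeMap_bijective hx).2 g
  rw [← ofPolynomial_X, ← freeMap_smul] at hg
  have h1 := (injective_iff_map_eq_zero _).1 (hb.freeMap_injective hx) _ hg
  rw [smul_eq_zero_iff_right Polynomial.X_ne_zero] at h1
  rw [h1, map_zero]

/-- Regularity of x* rules out torsion summands. The generators of the free summands then come from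
a second free basis, and γₙ, which depends only on x, counts its members of degree n. -/
theorem IsFreeBasis.eq_aperyInvariant (hb : IsFreeBasis x d y)
    (h : IsRegularReduction x (reductionNumber x)) {α : ℕ → ℕ} {τ : ℕ → ℕ → ℕ}
    (hα : IsTangentConeInvariants x h.mem α τ) (n : ℕ) : α n = aperyInvariant x n := by
  classical
  obtain ⟨hα0, φ, hφ, hgr⟩ := hα
  obtain hn | hn := lt_or_ge (reductionNumber x) n
  · rw [hα0 n hn, hb.aperyInvariant_eq h.mem, eq_comm, Fintype.card_eq_zero_iff]
    exact ⟨fun s => by have := hb.degree_le h s; have := s.2; omega⟩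
  let ι' := Σ i : Fin (reductionNumber x + 1), Fin (α i)
  let κ := Σ p : TorsionIndex (reductionNumber x), Fin (τ p.1.1 p.1.2)
  have hmapx : FiberCone.map ((Ideal.span_singleton_le_iff_mem _).2 h.mem)
      (ofDegreeOne (Ideal.span {x}) x (Ideal.mem_span_singleton_self x)) =
        ofDegreeOne _ x h.mem := by
    rw [← ofPolynomial_X, map_ofPolynomial, ofPolynomial_X]
  -- A torsion summand would contain the nonzero class of (x*)ʲ⁻¹, killed by x*.
  have hκ : IsEmpty κ := by
    refine ⟨fun s => ?_⟩
    have h1 := hφ (ofDegreeOne (Ideal.span {x}) x (Ideal.mem_span_singleton_self x))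
      (φ.symm (0, Pi.single s (Ideal.Quotient.mk _
        (ofDegreeOne (Ideal.span {x}) x (Ideal.mem_span_singleton_self x) ^ (s.1.1.2 - 1)))))
    rw [hmapx, φ.apply_symm_apply, Prod.smul_mk, smul_zero, ← Pi.single_smul] at h1
    have h2 : ofDegreeOne (Ideal.span {x}) x (Ideal.mem_span_singleton_self x) •
        (Ideal.Quotient.mk (Ideal.span {ofDegreeOne (Ideal.span {x}) x
          (Ideal.mem_span_singleton_self x) ^ s.1.1.2})
        (ofDegreeOne (Ideal.span {x}) x (Ideal.mem_span_singleton_self x) ^ (s.1.1.2 - 1))) = 0 := by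
      rw [← Ideal.Quotient.mk_eq_mk, ← Submodule.Quotient.mk_smul, smul_eq_mul, mul_pow_sub_one
        (by have := s.1.2; omega), Submodule.Quotient.mk_eq_zero]
      exact Ideal.mem_span_singleton_self _
    rw [h2, Pi.single_zero] at h1
    have h3 := hb.eq_zero_of_mul_eq_zero h.mem ((map_eq_zero_iff φ φ.injective).1 h1)
    rw [AddEquiv.symm_apply_eq, map_zero] at h3
    have h4 := congrFun (congrArg Prod.snd h3) s
    exact h.pow_notMem_span_pow (by have := s.1.2; omega)
      (Ideal.Quotient.eq_zero_iff_mem.1 ((Pi.single_eq_same s _).symm.trans h4))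
  -- The generator of F(x)(-i) is homogeneous of degree i, hence the class of some element of 𝔪ⁱ.
  have hE : ∀ s : ι', ∃ a, ∃ ha : a ∈ maximalIdeal A ^ (s.1 : ℕ),
      φ.symm (Pi.single s 1, 0) = form _ (s.1 : ℕ) a ha := by
    intro s
    refine exists_form_of_mem_piece ((hgr _ _).2 ?_)
    rw [φ.apply_symm_apply]
    refine ⟨fun t _ => ?_, zero_mem _⟩
    change (Pi.single s (1 : FiberCone (Ideal.span {x})) : ι' → _) t ∈ shiftPiece _ (t.1 : ℕ) _
    obtain rfl | hst := eq_or_ne t s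
    · rw [Pi.single_eq_same, shiftPiece, if_pos le_rfl, Nat.sub_self]
      exact ⟨_, rfl⟩
    · rw [Pi.single_eq_of_ne hst]
      exact zero_mem _
  choose y' hy' hE using hE
  have hfree : ∀ f : ι' → (ResidueField A)[X],
      φ (freeMap h.mem (fun s : ι' => (s.1 : ℕ)) y' hy' f) = (fun s => h.polynomialEquiv (f s), 0) := by
    intro f
    refine Prod.ext ?_ (Subsingleton.elim _ _)
    have h1 : φ (freeMap h.mem (fun s : ι' => (s.1 : ℕ)) y' hy' f) =
        ∑ s, h.polynomialEquiv (f s) • (Pi.single s 1, 0) := by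
      rw [freeMap_apply, map_sum]
      refine Finset.sum_congr rfl fun s _ => ?_
      rw [← hE, ← h.map_polynomialEquiv, hφ, φ.apply_symm_apply]
    rw [h1, Prod.fst_sum]
    funext t
    rw [Finset.sum_apply, Finset.sum_eq_single t]
    · simp
    · intro s _ hst
      simp [Pi.single_eq_of_ne hst.symm]
    · simp
  have hb' : IsFreeBasis x (fun s : ι' => (s.1 : ℕ)) y' := by
    refine isFreeBasis_of_freeMap h.mem hy' ?_ ?_
    · intro f f' hff
      have h1 := congrArg φ hff
      rw [hfree, hfree] at h1
      funext s
      exact h.polynomialEquiv.injective (congrFun (congrArg Prod.fst h1) s)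
    · intro k g hg
      obtain ⟨h1, -⟩ := (hgr k g).1 hg
      have h2 : (φ g).1 = fun s => h.polynomialEquiv (h.polynomialEquiv.symm ((φ g).1 s)) := by
        funext s
        simp
      rw [h2] at h1
      refine ⟨_, h.polynomialEquiv_mem_sumPiece_iff.1 h1, φ.injective ?_⟩
      rw [hfree, ← h2]
      exact Prod.ext rfl (Subsingleton.elim _ _)
  rw [hb'.aperyInvariant_eq h.mem]
  have h1 : Fintype.card {s : ι' // (s.1 : ℕ) = n} =
      Fintype.card {s : ι' // s.1 = ⟨n, Nat.lt_succ_of_le hn⟩} :=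
    Fintype.card_congr (Equiv.subtypeEquivRight fun s => by simp [Fin.ext_iff])
  rw [h1, Fintype.card_congr (Equiv.sigmaSubtype _), Fintype.card_fin]

end Decomposition

theorem exists_addEquiv_of_ker_eq {M N P : Type*} [AddCommGroup M] [AddCommGroup N]
    [AddCommGroup P] (f : M →+ N) (g : M →+ P) (hf : Function.Surjective f)
    (hg : Function.Surjective g) (h : ∀ m, f m = 0 ↔ g m = 0) :
    ∃ φ : N ≃+ P, ∀ m, φ (f m) = g m := by
  have hk : f.ker = g.ker := by
    ext m
    exact h m
  refine ⟨((QuotientAddGroup.quotientKerEquivOfSurjective f hf).symm.trans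
    (QuotientAddGroup.quotientAddEquivOfEq hk)).trans
      (QuotientAddGroup.quotientKerEquivOfSurjective g hg), fun m => ?_⟩
  have h1 : (QuotientAddGroup.quotientKerEquivOfSurjective f hf).symm (f m) =
      (m : M ⧸ f.ker) := by
    rw [AddEquiv.symm_apply_eq]
    rfl
  rw [AddEquiv.trans_apply, AddEquiv.trans_apply, h1]
  rfl

/-! ### Power series acting through x -/

section PowerSeriesEval

variable {A : Type u} [CommRing A] [IsLocalRing A] {K : Type u} [Field K] (σ : K →+* A) {x : A}

theorem eval₂_sub_mem_pow (hx : x ∈ maximalIdeal A) {n : ℕ} {p q : K[X]}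
    (h : ∀ k < n, p.coeff k = q.coeff k) :
    p.eval₂ σ x - q.eval₂ σ x ∈ maximalIdeal A ^ n := by
  have h1 : (Polynomial.X : K[X]) ^ n ∣ p - q := by
    rw [Polynomial.X_pow_dvd_iff]
    intro k hk
    rw [Polynomial.coeff_sub, h k hk, sub_self]
  obtain ⟨g, hg⟩ := h1
  rw [← Polynomial.eval₂_sub, hg, Polynomial.eval₂_mul, Polynomial.eval₂_X_pow]
  exact Ideal.mul_mem_right _ _ (Ideal.pow_mem_pow hx n)

/-- The homomorphism `K⟦X⟧ → A / 𝔪ⁿ` that extends `σ` and sends `X` to the class of `x`. -/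
def truncEval (hx : x ∈ maximalIdeal A) (n : ℕ) : K⟦X⟧ →+* A ⧸ maximalIdeal A ^ n where
  toFun f := Ideal.Quotient.mk _ ((PowerSeries.trunc n f).eval₂ σ x)
  map_zero' := by simp
  map_one' := by
    rw [← map_one (Ideal.Quotient.mk _), ← Polynomial.eval₂_one σ x, Ideal.Quotient.eq]
    refine eval₂_sub_mem_pow σ hx fun k hk => ?_
    rw [PowerSeries.coeff_trunc, if_pos hk, PowerSeries.coeff_one, Polynomial.coeff_one]
  map_add' f g := by
    rw [← map_add, ← Polynomial.eval₂_add, map_add]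
  map_mul' f g := by
    rw [← map_mul, ← Polynomial.eval₂_mul, Ideal.Quotient.eq]
    refine eval₂_sub_mem_pow σ hx fun k hk => ?_
    rw [PowerSeries.coeff_trunc, if_pos hk, PowerSeries.coeff_mul_eq_coeff_trunc_mul_trunc f g hk,
      ← Polynomial.coe_mul, Polynomial.coeff_coe]

theorem truncEval_apply (hx : x ∈ maximalIdeal A) (n : ℕ) (f : K⟦X⟧) :
    truncEval σ hx n f = Ideal.Quotient.mk _ ((PowerSeries.trunc n f).eval₂ σ x) :=
  rfl

/-- The truncated evaluations are compatible because xⁿ ∈ 𝔪ⁿ, so they glue by completeness;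
separatedness identifies the result on polynomials. -/
theorem exists_powerSeries_eval [IsAdicComplete (maximalIdeal A) A] (hx : x ∈ maximalIdeal A) :
    ∃ ψ : K⟦X⟧ →+* A, ψ.comp (PowerSeries.C : K →+* K⟦X⟧) = σ ∧ ψ PowerSeries.X = x := by
  let ψ : K⟦X⟧ →+* A := IsAdicComplete.liftRingHom (maximalIdeal A) (truncEval σ hx) (by
    intro m n hmn
    ext f
    rw [RingHom.comp_apply, truncEval_apply, truncEval_apply]
    refine Ideal.Quotient.eq.2 (eval₂_sub_mem_pow σ hx fun k hk => ?_)
    rw [PowerSeries.coeff_trunc, PowerSeries.coeff_trunc, if_pos (hk.trans_le hmn), if_pos hk])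
  have hψ : ∀ p : K[X], ψ p = p.eval₂ σ x := by
    intro p
    rw [← sub_eq_zero]
    refine IsHausdorff.haus (I := maximalIdeal A) inferInstance _ fun n => ?_
    rw [SModEq.zero, smul_eq_mul, Ideal.mul_top, ← Ideal.Quotient.eq_zero_iff_mem, map_sub,
      sub_eq_zero]
    refine (IsAdicComplete.mk_liftRingHom (maximalIdeal A) _ _ n (p : K⟦X⟧)).trans ?_
    refine Ideal.Quotient.eq.2 (eval₂_sub_mem_pow σ hx fun k hk => ?_)
    rw [PowerSeries.coeff_trunc, if_pos hk, Polynomial.coeff_coe]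
  refine ⟨ψ, RingHom.ext fun a => ?_, ?_⟩
  · rw [RingHom.comp_apply, ← Polynomial.coe_C, hψ, Polynomial.eval₂_C]
  · rw [← Polynomial.coe_X, hψ, Polynomial.eval₂_X]

variable {σ} {ψ : K⟦X⟧ →+* A} (hσ : ψ.comp (PowerSeries.C : K →+* K⟦X⟧) = σ)
  (hX : ψ PowerSeries.X = x) {N : Type*} [AddCommGroup N] [Module A N] {ι : Type*} [Fintype ι]
  (w : ι → N)

include hσ hX

-- The splitting f = f(0) + X·(shifted f) isolates constant terms modulo x; both the spanning and
-- the independence argument iterate it.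
omit [IsLocalRing A] in
theorem sum_powerSeries_smul_eq (f : ι → K⟦X⟧) : ∑ s, ψ (f s) • w s =
    ∑ s, σ (PowerSeries.constantCoeff (f s)) • w s +
      x • ∑ s, ψ (PowerSeries.mk fun k => PowerSeries.coeff (k + 1) (f s)) • w s := by
  rw [Finset.smul_sum, ← Finset.sum_add_distrib]
  refine Finset.sum_congr rfl fun s _ => ?_
  conv_lhs => rw [PowerSeries.eq_X_mul_shift_add_const (f s), map_add, map_mul, hX,
    ← RingHom.comp_apply, hσ, add_smul, mul_smul]
  rw [add_comm]

omit [IsLocalRing A] in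
/-- Successive approximation: a module that is separated for the powers of `x` is spanned over
`K⟦X⟧` by a family that spans it over `K` modulo `x`. -/
theorem exists_sum_powerSeries_smul_eq
    (hspan : ∀ z : N, ∃ (c : ι → K) (z' : N), z = ∑ s, σ (c s) • w s + x • z')
    (hsep : ∀ u : N, (∀ k : ℕ, ∃ v, u = x ^ k • v) → u = 0) (z : N) :
    ∃ f : ι → K⟦X⟧, z = ∑ s, ψ (f s) • w s := by
  choose c t hct using hspan
  -- z' k is the k-th remainder and f k collects the coefficients from step k on, so each error is x
  -- times the next one.
  let z' : ℕ → N := fun k => t^[k] z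
  let f : ℕ → ι → K⟦X⟧ := fun k s => PowerSeries.mk fun j => c (z' (k + j)) s
  have hstep : ∀ k, z' k - ∑ s, ψ (f k s) • w s =
      x • (z' (k + 1) - ∑ s, ψ (f (k + 1) s) • w s) := by
    intro k
    have h1 : z' (k + 1) = t (z' k) := Function.iterate_succ_apply' t k z
    have h2 : ∀ s, (PowerSeries.mk fun j => PowerSeries.coeff (j + 1) (f k s)) = f (k + 1) s := by
      intro s
      ext j
      simp only [f, PowerSeries.coeff_mk]
      rw [show k + (j + 1) = k + 1 + j by ring]
    have h3 : ∀ s, PowerSeries.constantCoeff (f k s) = c (z' k) s := fun s => by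
      rw [← PowerSeries.coeff_zero_eq_constantCoeff_apply, PowerSeries.coeff_mk, add_zero]
    rw [sum_powerSeries_smul_eq hσ hX, h1]
    simp only [h2, h3]
    rw [sub_eq_iff_eq_add]
    refine (hct (z' k)).trans ?_
    rw [smul_sub]
    abel
  have hpow : ∀ k, z - ∑ s, ψ (f 0 s) • w s = x ^ k • (z' k - ∑ s, ψ (f k s) • w s) := by
    intro k
    induction k with
    | zero => rw [pow_zero, one_smul]; rfl
    | succ k ih => rw [ih, hstep, smul_smul, pow_succ]
  exact ⟨f 0, sub_eq_zero.1 (hsep _ fun k => ⟨_, hpow k⟩)⟩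

-- Independence modulo x kills the constant terms; cancelling x leaves the same relation for the
-- shifted series.
omit [IsLocalRing A] in
theorem eq_zero_of_sum_powerSeries_smul_eq_zero (hreg : ∀ z : N, x • z = 0 → z = 0)
    (hind : ∀ (c : ι → K) (z : N), ∑ s, σ (c s) • w s = x • z → ∀ s, c s = 0)
    (f : ι → K⟦X⟧) (hf : ∑ s, ψ (f s) • w s = 0) : f = 0 := by
  suffices H : ∀ (k : ℕ) (f : ι → K⟦X⟧), ∑ s, ψ (f s) • w s = 0 →
      ∀ s, PowerSeries.coeff k (f s) = 0 by
    funext s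
    ext k
    exact H k f hf s
  intro k
  induction k with
  | zero =>
    intro f hf s
    rw [sum_powerSeries_smul_eq hσ hX, add_eq_zero_iff_eq_neg, ← smul_neg] at hf
    rw [PowerSeries.coeff_zero_eq_constantCoeff_apply]
    exact hind _ _ hf s
  | succ k ih =>
    intro f hf s
    rw [sum_powerSeries_smul_eq hσ hX] at hf
    have h0 := hind _ _ (by rw [add_eq_zero_iff_eq_neg, ← smul_neg] at hf; exact hf)
    simp only [h0, map_zero, zero_smul, Finset.sum_const_zero, zero_add] at hf
    simpa using ih _ (hreg _ hf) s

end PowerSeriesEval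

/-! ### The K⟦X⟧-module A'/A -/

section Equicharacteristic

variable {A : Type u} [CommRing A] [IsLocalRing A] {x : A} {r : ℕ} {ι : Type*} [Fintype ι]
  {d : ι → ℕ} {y : ι → A} {σ : ResidueField A →+* A}

theorem IsCoefficientField.sub_mem (hσ : IsCoefficientField σ) (a : A) :
    a - σ (residue A a) ∈ maximalIdeal A := by
  rw [← residue_eq_zero_iff, map_sub, sub_eq_zero]
  exact (congrArg (fun f : ResidueField A →+* ResidueField A => f (residue A a)) hσ).symm

theorem IsCoefficientField.eq_zero_of_mem (hσ : IsCoefficientField σ) {c : ResidueField A}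
    (hc : σ c ∈ maximalIdeal A) : c = 0 := by
  rw [← residue_eq_zero_iff] at hc
  exact (congrArg (fun f : ResidueField A →+* ResidueField A => f c) hσ).symm.trans hc

/-- The `yₛ` span `A` modulo `x` over a coefficient field. -/
theorem IsFreeBasis.exists_eq_sum_add_mul (hb : IsFreeBasis x d y) (h : IsRegularReduction x r)
    (hσ : IsCoefficientField σ) (a : A) :
    ∃ (c : ι → ResidueField A) (a' : A), a = ∑ s, σ (c s) • y s + x • a' := by
  classical
  -- Descending induction on n, starting from 𝔪ʳ⁺¹ ⊆ xA.
  suffices H : ∀ n ≤ r + 1, ∀ a ∈ maximalIdeal A ^ n,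
      ∃ (c : ι → ResidueField A) (a' : A), a = ∑ s, σ (c s) * y s + x * a' from
    H 0 (Nat.zero_le _) a (by simp)
  intro n hn
  induction hn using Nat.decreasingInduction with
  | self =>
    intro a ha
    obtain ⟨b, -, rfl⟩ := h.exists_eq_pow_mul (k := 1) le_rfl ha
    exact ⟨0, b, by simp⟩
  | of_succ n _ ih =>
    intro a ha
    obtain ⟨c, hc⟩ := hb.exists_sub_sum_mem n (Submodule.mem_sup_left ha)
    obtain ⟨a1, ha1, w, hw, ha1w⟩ := Submodule.mem_sup.1 hc
    obtain ⟨a2, rfl⟩ := Ideal.mem_span_singleton.1 hw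
    -- Replacing coefficients by representatives in K costs an error one degree higher, which the
    -- induction hypothesis absorbs.
    have h1 : ∑ s : {s // d s = n}, (c s - σ (residue A (c s))) * y s ∈
        maximalIdeal A ^ (n + 1) := by
      refine Ideal.sum_mem _ fun s _ => ?_
      rw [pow_succ']
      refine Ideal.mul_mem_mul (hσ.sub_mem _) ?_
      have := hb.mem s
      rwa [s.2] at this
    obtain ⟨c', a', hca'⟩ := ih _ (Ideal.add_mem _ ha1 h1)
    refine ⟨fun s => (if d s = n then residue A (c s) else 0) + c' s, a' + a2, ?_⟩
    have h2 : ∑ s, σ ((if d s = n then residue A (c s) else 0) + c' s) * y s =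
        ∑ s : {s // d s = n}, σ (residue A (c s)) * y s + ∑ s, σ (c' s) * y s := by
      rw [sum_subtype_eq_sum_ite (fun s => d s = n) fun s => σ (residue A (c s)) * y s,
        ← Finset.sum_add_distrib]
      refine Finset.sum_congr rfl fun s _ => ?_
      rw [map_add, add_mul]
      congr 1
      split_ifs <;> simp
    have h3 : ∑ s : {s // d s = n}, (c s - σ (residue A (c s))) * y s =
        ∑ s : {s // d s = n}, c s * y s - ∑ s : {s // d s = n}, σ (residue A (c s)) * y s := by
      rw [← Finset.sum_sub_distrib]
      exact Finset.sum_congr rfl fun s _ => sub_mul _ _ _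
    rw [h3] at hca'
    rw [h2]
    linear_combination hca' - ha1w

theorem eq_zero_of_forall_mem_pow [IsNoetherianRing A] {a : A}
    (ha : ∀ k, a ∈ maximalIdeal A ^ k) : a = 0 := by
  have := Ideal.iInf_pow_eq_bot_of_isLocalRing (maximalIdeal A) (maximalIdeal.isMaximal A).ne_top
  have h2 : a ∈ ⨅ i, maximalIdeal A ^ i := (Submodule.mem_iInf _).2 ha
  rw [this] at h2
  exact h2

/-- The fractions wₛ = yₛ/x^{dₛ} are a K⟦X⟧-basis of A', and the yₛ = X^{dₛ}wₛ span A, so A'/A is ⨁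
K⟦X⟧/X^{dₛ}. Indices with dₛ = 0 contribute nothing, which is why j only has to reach the others. -/
theorem IsFreeBasis.neighborhoodQuotientIso [IsNoetherianRing A] (hb : IsFreeBasis x d y)
    (h : IsRegularReduction x r) (hσ : IsCoefficientField σ) {ψ : (ResidueField A)⟦X⟧ →+* A}
    (hψσ : ψ.comp (PowerSeries.C : ResidueField A →+* (ResidueField A)⟦X⟧) = σ)
    (hψX : ψ PowerSeries.X = x) {κ : Type} [Fintype κ] (j : κ → ι) (hj : Function.Injective j)
    (hd : ∀ s, d s ≠ 0 → s ∈ Set.range j) : NeighborhoodQuotientIso ψ (fun s => d (j s)) := by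
  classical
  have hdr := hb.degree_le h
  choose w hw using fun s => h.exists_smul_eq r (x ^ (r - d s) * y s)
  let W : ι → firstNeighborhood A := fun s => ⟨w s,
    (h.mem_firstNeighborhood_iff le_rfl).2 ⟨_, hb.pow_mul_mem h.mem (hdr s), hw s⟩⟩
  have hcancel : ∀ {k : ℕ} {z z' : firstNeighborhood A}, x ^ k • z = x ^ k • z' → z = z' :=
    fun hz => Subtype.ext (h.smul_cancel (congrArg Subtype.val hz))
  have hWsum : ∀ c : ι → A, x ^ r • ((∑ s, c s • W s : firstNeighborhood A) : FractionRing A) =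
      algebraMap A _ (shiftedSum x d y r c) := by
    intro c
    rw [AddSubmonoidClass.coe_finsetSum, Finset.smul_sum, shiftedSum, map_sum]
    refine Finset.sum_congr rfl fun s _ => ?_
    rw [if_pos (hdr s), SetLike.val_smul, smul_comm, hw, Algebra.smul_def, ← map_mul]
  have hWd : ∀ s, x ^ d s • W s = algebraMap A _ (y s) := by
    intro s
    refine hcancel (k := r) (Subtype.ext ?_)
    change x ^ r • x ^ d s • w s = x ^ r • algebraMap A (FractionRing A) (y s)
    rw [smul_comm, hw, Algebra.smul_def, Algebra.smul_def, ← map_mul, ← map_mul, ← mul_assoc,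
      ← pow_add, Nat.add_sub_cancel' (hdr s)]
  have hsurj : ∀ z : firstNeighborhood A, ∃ f : ι → (ResidueField A)⟦X⟧,
      z = ∑ s, ψ (f s) • W s := by
    refine exists_sum_powerSeries_smul_eq hψσ hψX W ?_ ?_
    · intro z
      obtain ⟨b, hbm, hz⟩ := (h.mem_firstNeighborhood_iff le_rfl).1 z.2
      obtain ⟨c, hc⟩ := hb.span r b hbm
      have h1 : b - shiftedSum x d y r (fun s => σ (residue A (c s))) ∈
          maximalIdeal A ^ (r + 1) := by
        have h2 := shiftedSum_sub_mem h.mem hb.mem (n := r) (c := c)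
          (c' := fun s => σ (residue A (c s))) fun s _ => hσ.sub_mem _
        rw [← pow_succ'] at h2
        simpa using Ideal.add_mem _ hc h2
      obtain ⟨b', hb', hbb'⟩ := h.exists_eq_pow_mul (k := 1) le_rfl h1
      obtain ⟨z', hz'⟩ := h.exists_smul_eq r b'
      refine ⟨fun s => residue A (c s),
        ⟨z', (h.mem_firstNeighborhood_iff le_rfl).2 ⟨b', hb', hz'⟩⟩,
        Subtype.ext (h.smul_cancel (n := r) ?_)⟩
      rw [hz, AddMemClass.coe_add, smul_add, hWsum, SetLike.val_smul, smul_comm, hz',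
        Algebra.smul_def, ← map_mul, ← map_add]
      congr 1
      linear_combination hbb'
    -- If u lies in all xᵏA', then xʳu lies in all 𝔪ᵏ and vanishes by Krull's intersection theorem.
    · intro u hu
      obtain ⟨b, -, hub⟩ := (h.mem_firstNeighborhood_iff le_rfl).1 u.2
      have hb0 : b = 0 := by
        refine eq_zero_of_forall_mem_pow fun k => ?_
        obtain ⟨v, rfl⟩ := hu k
        obtain ⟨b', hb', hvb⟩ := (h.mem_firstNeighborhood_iff le_rfl).1 v.2
        rw [SetLike.val_smul, smul_comm, hvb, Algebra.smul_def, ← map_mul] at hub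
        rw [← algebraMap_fractionRing_injective hub]
        exact Ideal.mul_mem_right _ _ (Ideal.pow_mem_pow h.mem k)
      refine Subtype.ext (h.smul_cancel (n := r) ?_)
      rw [hub, hb0, map_zero, ZeroMemClass.coe_zero, smul_zero]
  have hinj : ∀ f : ι → (ResidueField A)⟦X⟧, ∑ s, ψ (f s) • W s = 0 → f = 0 := by
    refine eq_zero_of_sum_powerSeries_smul_eq_zero hψσ hψX W
      (fun z hz => hcancel (k := 1) (by rw [pow_one, hz, smul_zero])) fun c z hcz s => ?_
    obtain ⟨b, hbm, hz⟩ := (h.mem_firstNeighborhood_iff le_rfl).1 z.2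
    have h1 := hWsum fun s => σ (c s)
    rw [hcz, SetLike.val_smul, smul_comm, hz, Algebra.smul_def, ← map_mul] at h1
    refine hσ.eq_zero_of_mem (hb.indep r (fun s => σ (c s)) ?_ s (hdr s))
    rw [← algebraMap_fractionRing_injective h1, pow_succ']
    exact Ideal.mul_mem_mul h.mem hbm
  have hA : ∀ a : A, ∃ f : ι → (ResidueField A)⟦X⟧, a = ∑ s, ψ (f s) • y s := by
    refine exists_sum_powerSeries_smul_eq hψσ hψX y (hb.exists_eq_sum_add_mul h hσ) ?_
    intro u hu
    refine eq_zero_of_forall_mem_pow fun k => ?_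
    obtain ⟨v, rfl⟩ := hu k
    exact Ideal.mul_mem_right _ _ (Ideal.pow_mem_pow h.mem k)
  have hψd : ∀ (s : ι) (g : (ResidueField A)⟦X⟧),
      ψ (PowerSeries.X ^ d s * g) • W s = algebraMap A _ (ψ g • y s) := by
    intro s g
    rw [map_mul, map_pow, hψX, mul_comm, mul_smul, hWd, smul_eq_mul, map_mul, Algebra.smul_def]
  let f₁ : (ι → (ResidueField A)⟦X⟧) →+ NeighborhoodQuotient A :=
    { toFun := fun f => Submodule.Quotient.mk (∑ s, ψ (f s) • W s)
      map_zero' := by simp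
      map_add' := fun f g => by
        rw [← Submodule.Quotient.mk_add, ← Finset.sum_add_distrib]
        simp only [Pi.add_apply, map_add, add_smul] }
  let f₂ : (ι → (ResidueField A)⟦X⟧) →+ (∀ s : κ, (ResidueField A)⟦X⟧ ⧸
      Ideal.span {(PowerSeries.X : (ResidueField A)⟦X⟧) ^ d (j s)}) :=
    { toFun := fun f s => Ideal.Quotient.mk _ (f (j s))
      map_zero' := by funext s; simp
      map_add' := fun f g => by funext s; simp }
  -- An element of A' lies in A exactly when its coordinate at wₛ is divisible by X^{dₛ}: expand it
  -- in the yₛ and compare coordinates.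
  have hker₁ : ∀ f, f₁ f = 0 ↔ ∀ s, (PowerSeries.X : (ResidueField A)⟦X⟧) ^ d s ∣ f s := by
    intro f
    refine (Submodule.Quotient.mk_eq_zero _).trans ?_
    rw [LinearMap.mem_range]
    constructor
    · rintro ⟨a, ha⟩
      obtain ⟨g, rfl⟩ := hA a
      have h1 : (fun s => f s - PowerSeries.X ^ d s * g s) = 0 := by
        apply hinj
        simp only [map_sub, sub_smul, Finset.sum_sub_distrib, ← ha, hψd]
        rw [Algebra.linearMap_apply, map_sum, sub_self]
      intro s
      exact ⟨g s, sub_eq_zero.1 (congrFun h1 s)⟩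
    · intro hf
      choose g hg using hf
      refine ⟨∑ s, ψ (g s) • y s, ?_⟩
      rw [Algebra.linearMap_apply, map_sum]
      exact Finset.sum_congr rfl fun s _ => by rw [hg s, hψd]
  have hker₂ : ∀ f, f₂ f = 0 ↔ ∀ s, (PowerSeries.X : (ResidueField A)⟦X⟧) ^ d s ∣ f s := by
    intro f
    have h1 : f₂ f = 0 ↔ ∀ s, (PowerSeries.X : (ResidueField A)⟦X⟧) ^ d (j s) ∣ f (j s) := by
      rw [funext_iff]
      refine forall_congr' fun s => ?_
      rw [← Ideal.mem_span_singleton, ← Ideal.Quotient.eq_zero_iff_mem]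
      rfl
    rw [h1]
    constructor
    · intro hf s
      by_cases hs : d s = 0
      · rw [hs, pow_zero]
        exact one_dvd _
      · obtain ⟨t, rfl⟩ := hd s hs
        exact hf t
    · exact fun hf s => hf _
  have hs₁ : Function.Surjective f₁ := by
    intro z
    obtain ⟨z, rfl⟩ := Submodule.Quotient.mk_surjective _ z
    obtain ⟨f, rfl⟩ := hsurj z
    exact ⟨f, rfl⟩
  have hs₂ : Function.Surjective f₂ := by
    intro z
    choose g hg using fun s => Ideal.Quotient.mk_surjective (z s)
    refine ⟨Function.extend j g 0, funext fun s => ?_⟩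
    change Ideal.Quotient.mk _ (Function.extend j g 0 (j s)) = z s
    rw [hj.extend_apply, hg]
  obtain ⟨φ, hφ⟩ := exists_addEquiv_of_ker_eq f₁ f₂ hs₁ hs₂ fun f =>
    (hker₁ f).trans (hker₂ f).symm
  refine ⟨φ, fun p z => ?_⟩
  obtain ⟨f, rfl⟩ := hs₁ z
  have h1 : ψ p • f₁ f = f₁ (p • f) := by
    change ψ p • Submodule.Quotient.mk _ = Submodule.Quotient.mk _
    rw [← Submodule.Quotient.mk_smul, Finset.smul_sum]
    simp only [Pi.smul_apply, smul_eq_mul, map_mul, mul_smul]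
  rw [h1, hφ, hφ]
  rfl

theorem IsFreeBasis.equicharacteristicCompleteDecomposition [IsNoetherianRing A]
    (hb : IsFreeBasis x d y) (h : IsRegularReduction x r) {κ : Type} [Fintype κ] (j : κ → ι)
    (hj : Function.Injective j) (hd : ∀ s, d s ≠ 0 → s ∈ Set.range j) :
    EquicharacteristicCompleteDecomposition x (fun s => d (j s)) := by
  intro hchar hcomplete
  refine ⟨exists_isCoefficientField hchar, fun σ hσ => ?_⟩
  obtain ⟨ψ, hψσ, hψX⟩ := exists_powerSeries_eval σ h.mem
  exact ⟨ψ, hψσ, hψX, hb.neighborhoodQuotientIso h hσ hψσ hψX j hj hd⟩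

end Equicharacteristic

theorem IsFreeBasis.hilbertSeries_map_eq {A : Type u} [CommRing A] [IsLocalRing A] {x : A}
    {ι : Type*} [Fintype ι] {d : ι → ℕ} {y : ι → A} (hb : IsFreeBasis x d y)
    (hx : x ∈ maximalIdeal A) :
    hilbertSeries ((maximalIdeal A).map (Ideal.Quotient.mk (Ideal.span {x}))) =
      ∑ s, PowerSeries.X ^ d s := by
  ext n
  rw [hilbertSeries, PowerSeries.coeff_mk, hb.hilbertFunction_map_eq hx, map_sum,
    Fintype.card_subtype]
  simp [PowerSeries.coeff_X_pow, eq_comm]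

end TangentCone

end

/-! ### The two cases -/

theorem mainTheorem12 (A : Type u) [CommRing A] [IsLocalRing A] [IsNoetherianRing A]
    (hCM : TangentCone.IsCohenMacaulayLocal A) (hdim : ringKrullDim A = 1)
    [Infinite (IsLocalRing.ResidueField A)]
    (x : A)
    (hx : TangentCone.IsMinimalReduction (Ideal.span {x}) (IsLocalRing.maximalIdeal A)) :
    (TangentCone.embDim A = 2 →
      ((∃ α τ, TangentCone.IsTangentConeInvariants x hx.mem α τ) ∧
        (∀ α τ, TangentCone.IsTangentConeInvariants x hx.mem α τ →
          ∀ i, 1 ≤ i → i < TangentCone.multiplicity A → α i = 1) ∧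
        ∀ i, 1 ≤ i → i < TangentCone.multiplicity A →
          TangentCone.microInvariant A i = 1 ∧ TangentCone.aperyInvariant x i = 1) ∧
      TangentCone.TangentConeIsoFree x hx.mem
        (fun i : Fin (TangentCone.multiplicity A) => (i : ℕ)) ∧
      TangentCone.hilbertSeries
          ((IsLocalRing.maximalIdeal A).map (Ideal.Quotient.mk (Ideal.span {x}))) =
        ∑ i ∈ Finset.range (TangentCone.multiplicity A), PowerSeries.X ^ i ∧
      TangentCone.EquicharacteristicCompleteDecomposition x
        (fun i : Fin (TangentCone.multiplicity A - 1) => (i : ℕ) + 1)) ∧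
    (TangentCone.embDim A = TangentCone.multiplicity A →
      ((∃ α τ, TangentCone.IsTangentConeInvariants x hx.mem α τ) ∧
        (∀ α τ, TangentCone.IsTangentConeInvariants x hx.mem α τ →
          (α 1 : ℤ) = (TangentCone.multiplicity A : ℤ) - 1) ∧
        TangentCone.microInvariant A 1 = (TangentCone.multiplicity A : ℤ) - 1 ∧
        (TangentCone.aperyInvariant x 1 : ℤ) = (TangentCone.multiplicity A : ℤ) - 1) ∧
      TangentCone.TangentConeIsoFree x hx.mem
        (Sum.elim (fun _ : Fin 1 => 0) (fun _ : Fin (TangentCone.multiplicity A - 1) => 1)) ∧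
      TangentCone.hilbertSeries
          ((IsLocalRing.maximalIdeal A).map (Ideal.Quotient.mk (Ideal.span {x}))) =
        1 + PowerSeries.C ((TangentCone.multiplicity A : ℤ) - 1) * PowerSeries.X ∧
      TangentCone.EquicharacteristicCompleteDecomposition x
        (fun _ : Fin (TangentCone.multiplicity A - 1) => 1)) := by
  have h := TangentCone.isRegularReduction_of_isMinimalReduction hCM hdim hx
  have he := TangentCone.multiplicity_pos h
  constructor
  · intro hb2
    obtain ⟨y, hb⟩ := TangentCone.exists_isFreeBasis_of_embDim_eq_two h hb2
    have hcard : ∀ i, i < TangentCone.multiplicity A →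
        Fintype.card {s : Fin (TangentCone.multiplicity A) // (s : ℕ) = i} = 1 := by
      intro i hi
      rw [Fintype.card_eq_one_iff]
      exact ⟨⟨⟨i, hi⟩, rfl⟩, fun s => Subtype.ext (Fin.ext s.2)⟩
    refine ⟨⟨⟨_, _, hb.isTangentConeInvariants h⟩, fun α τ hα i _ hi => ?_, fun i hi1 hi => ?_⟩,
      hb.tangentConeIsoFree hx.mem, ?_, ?_⟩
    · rw [hb.eq_aperyInvariant h hα, hb.aperyInvariant_eq hx.mem, hcard i hi]
    · rw [hb.microInvariant_eq h hi1, hb.aperyInvariant_eq hx.mem, hcard i hi]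
      exact ⟨Nat.cast_one, rfl⟩
    · rw [hb.hilbertSeries_map_eq hx.mem]
      exact Fin.sum_univ_eq_sum_range (fun i => (PowerSeries.X : PowerSeries ℤ) ^ i) _
    -- The generator 1 of degree 0 is left out, so the index i stands for y^{i+1}.
    · refine hb.equicharacteristicCompleteDecomposition h
        (fun i : Fin (TangentCone.multiplicity A - 1) => ⟨(i : ℕ) + 1, by omega⟩) ?_ ?_
      · intro i i' hii
        have := congrArg Fin.val hii
        exact Fin.ext (by simpa using this)
      · intro s hs
        exact ⟨⟨(s : ℕ) - 1, by omega⟩, Fin.ext (by simp only; omega)⟩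
  · intro hbe
    obtain ⟨y, hb⟩ := TangentCone.exists_isFreeBasis_of_minimal_multiplicity h hbe
    have hcard : Fintype.card {s : Fin 1 ⊕ Fin (TangentCone.multiplicity A - 1) //
        Sum.elim (fun _ => 0) (fun _ => 1) s = 1} = TangentCone.multiplicity A - 1 := by
      rw [Fintype.card_subtype, Finset.card_filter, Fintype.sum_sum_type]
      simp
    have hcard' : ((TangentCone.multiplicity A - 1 : ℕ) : ℤ) =
        (TangentCone.multiplicity A : ℤ) - 1 := by
      push_cast [Nat.one_le_iff_ne_zero.2 he.ne']
      ring
    refine ⟨⟨⟨_, _, hb.isTangentConeInvariants h⟩, fun α τ hα => ?_, ?_, ?_⟩,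
      hb.tangentConeIsoFree hx.mem, ?_, ?_⟩
    · rw [hb.eq_aperyInvariant h hα, hb.aperyInvariant_eq hx.mem, hcard, hcard']
    · rw [hb.microInvariant_eq h le_rfl, hcard, hcard']
    · rw [hb.aperyInvariant_eq hx.mem, hcard, hcard']
    · rw [hb.hilbertSeries_map_eq hx.mem, ← hcard']
      simp
    · refine hb.equicharacteristicCompleteDecomposition h Sum.inr Sum.inr_injective ?_
      rintro (s | s) hs
      · simp at hs
      · exact ⟨s, rfl⟩
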